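/- Let $A=\{a_1,\dots,a_n\}$ be a finite alphabet and $\tilde A=A\cup A^{-1}$. For a group $G$ with a choice of generators $A\to G$, let $\mu\colon\tilde A^*\to G$ be the induced evaluation of words. An automatic structure for $G$ over $A$ consists of a finite automaton over $\tilde A$ accepting a language $L$ with $\mu(L)=G$ and, for each $a\in\tilde A\cup\{1\}$, a finite automaton accepting exactly the (right-padded) pairs $(u,v)\in L\times L$ with $\mu(ua)=\mu(v)$. A subgroup $H\le G$ is $L$-quasi-convex if there is an integer $k$ such that for every $w\in L$ with $\mu(w)\in H$ the path in the Cayley graph of $G$ starting at $1$ and labeled by $w$ stays within distance $k$ of $H$. The Stallings graph $\Gamma_L(H)$ is the subgraph of the Schreier graph of $H$ (vertices the cosets $Hg$, edges $(Hg,a,Hg\mu(a))$ for $a\in A$) spanned by the vertex $H$ and the loops at $H$ labeled by words of $L\cap\mu^{-1}(H)$. The product $\Gamma\times_A\Gamma'$ of two $A$-labeled graphs has as vertices the pairs of vertices and as edges the triples $((p,p'),a,(q,q'))$ with $(p,a,q)$ an edge of $\Gamma$ and $(p',a,q')$ an edge of $\Gamma'$. There is an algorithm (a partial recursive function, depending only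 on $n$) with the following property. Let $G$ be a group with generators indexed by $A$ and with an automatic structure over $A$ whose word acceptor accepts $L$, and let $H=\langle\mu(h_1),\dots,\mu(h_s)\rangle$ and $K=\langle\mu(k_1),\dots,\mu(k_t)\rangle$ be finitely generated $L$-quasi-convex subgroups of $G$, where $h_i,k_j\in\tilde A^*$. On input the automata of the automatic structure and the words $h_1,\dots,h_s$, $k_1,\dots,k_t$, the algorithm halts and outputs finitely many words $w_1,\dots,w_m\in\tilde A^*$ such that $$\langle\mu(w_1),\dots,\mu(w_m)\rangle=H\cap K,$$ and such that, in the free group $F(A)$, the words $w_1,\dots,w_m$ generate exactly the set of those elements whose reduced word labels a loop at the base vertex $(H,K)$ in the connected component of $(H,K)$ in $\Gamma_L(H)\times_A\Gamma_L(K)$. -/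

import Mathlib

/-! ### Words and finite automata -/

/-- Letters `a_i` (coded `(i, true)`) and formal inverses `a_i⁻¹` (coded `(i, false)`)
over the alphabet `{a_0, …, a_{n-1}}`, with the convention of `FreeGroup (Fin n)`. -/
abbrev Letter (n : ℕ) : Type := Fin n × Bool

/-- Arbitrary (not necessarily reduced) words in the letters and their inverses. -/
abbrev GWord (n : ℕ) : Type := List (Letter n)

/-- A finite (non-deterministic) automaton over `α`, written down as finite data:
the list of initial states, the list of transitions `(p, x, q)`, the list of final states.
States are named by natural numbers. -/
abbrev FACode (α : Type) : Type := List ℕ × List (ℕ × α × ℕ) × List ℕ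

/-- The automaton described by a code. -/
def FACode.toNFA {α : Type} (c : FACode α) : NFA α ℕ where
  step p x := {q | (p, x, q) ∈ c.2.1}
  start := {q | q ∈ c.1}
  accept := {q | q ∈ c.2.2}

/-- The language accepted by the automaton described by a code. -/
def FACode.language {α : Type} (c : FACode α) : Language α := c.toNFA.accepts

/-- Letters of the padded two-tape alphabet; `none` is the padding symbol. -/
abbrev PadLetter (n : ℕ) : Type := Option (Letter n) × Option (Letter n)

/-- The pair `(u, v)` as a single word: the shorter word is padded on the right with `none`
up to the length of the longer one. -/
def padPair {n : ℕ} (u v : GWord n) : List (PadLetter n) := List.zipWithAll Prod.mk u v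

/-! ### Groups with generators and automatic structures -/

/-- The element of `G` represented by a word, the generator `a_i` being sent to `γ i`. -/
def evalWord {n : ℕ} {G : Type*} [Group G] (γ : Fin n → G) (w : GWord n) : G :=
  FreeGroup.lift γ (FreeGroup.mk w)

/-- The subgroup of `G` generated by the elements that the words in a list represent. -/
def generatedBy {n : ℕ} {G : Type*} [Group G] (γ : Fin n → G) (ws : List (GWord n)) :
    Subgroup G :=
  Subgroup.closure {g | ∃ w ∈ ws, evalWord γ w = g}

/-- The finite data of an automatic structure: the word acceptor, the multiplier for the empty
word, the multipliers for the letters `a_i`, and those for the letters `a_i⁻¹`. -/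
abbrev AutData (n : ℕ) : Type :=
  FACode (Letter n) × FACode (PadLetter n) ×
    (Fin n → FACode (PadLetter n)) × (Fin n → FACode (PadLetter n))

/-- The word acceptor. -/
def AutData.acceptor {n : ℕ} (d : AutData n) : FACode (Letter n) := d.1

/-- The multiplier automaton for a letter, or for the empty word (`none`). -/
def AutData.multiplier {n : ℕ} (d : AutData n) : Option (Letter n) → FACode (PadLetter n)
  | none => d.2.1
  | some (i, true) => d.2.2.1 i
  | some (i, false) => d.2.2.2 i

/-- The language `L` of the word acceptor. -/
def AutData.language {n : ℕ} (d : AutData n) : Language (Letter n) := d.acceptor.language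

/-- `d` is an automatic structure for `G` with the generators `γ`: the accepted language `L`
represents every element of `G`, and the multiplier for `a` accepts exactly the padded pairs
`(u, v)` with `u, v ∈ L` such that `u a` and `v` represent the same element.
(`a.toList` is the one-letter word `a`, or the empty word.) -/
def IsAutomaticStructure {n : ℕ} {G : Type*} [Group G] (γ : Fin n → G) (d : AutData n) : Prop :=
  (∀ g : G, ∃ w ∈ d.language, evalWord γ w = g) ∧
  ∀ (a : Option (Letter n)) (x : List (PadLetter n)),
    x ∈ (d.multiplier a).language ↔
      ∃ u ∈ d.language, ∃ v ∈ d.language,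
        evalWord γ (u ++ a.toList) = evalWord γ v ∧ x = padPair u v

/-- `S` is `L`-quasi-convex: for some `k`, every vertex of a path in the Cayley graph that
starts at `1` and is labeled by a word of `L` representing an element of `S` is at distance at
most `k` from `S` in the word metric. -/
def IsQuasiConvex {n : ℕ} {G : Type*} [Group G] (γ : Fin n → G) (L : Language (Letter n))
    (S : Set G) : Prop :=
  ∃ k : ℕ, ∀ w ∈ L, evalWord γ w ∈ S → ∀ p : GWord n, p <+: w →
    ∃ s ∈ S, ∃ v : GWord n, v.length ≤ k ∧ evalWord γ p * evalWord γ v = s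

/-! ### Labeled graphs -/

/-- A directed graph with edges labeled by `A`, on a set of vertices of type `V`. -/
structure AGraph (A V : Type*) where
  verts : Set V
  edges : Set (V × A × V)
  source_mem : ∀ e ∈ edges, e.1 ∈ verts
  target_mem : ∀ e ∈ edges, e.2.2 ∈ verts

namespace AGraph

variable {A V V' : Type*}

/-- The edge that is traversed when one moves from `p` to `q` reading a letter or an inverse
letter: an inverse letter is read against the orientation of the edge. -/
def traversed (p : V) (x : A × Bool) (q : V) : V × A × V :=
  if x.2 then (p, x.1, q) else (q, x.1, p)

/-- `Γ.IsPath p w q`: the word `w` labels a path from `p` to `q`. -/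
def IsPath (Γ : AGraph A V) : V → List (A × Bool) → V → Prop
  | p, [], q => p = q
  | p, x :: w, q => ∃ r, traversed p x r ∈ Γ.edges ∧ Γ.IsPath r w q

/-- The edge `e` is traversed by some loop at `v` whose label belongs to `W`. -/
def OnLoop (Γ : AGraph A V) (v : V) (W : Set (List (A × Bool))) (e : V × A × V) : Prop :=
  e ∈ Γ.edges ∧ ∃ u x w p q, u ++ x :: w ∈ W ∧
    Γ.IsPath v u p ∧ traversed p x q = e ∧ Γ.IsPath q w v

/-- The subgraph of `Γ` spanned by the loops at `v` labeled by the words of `W`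
(`v` itself always belongs to it). -/
def loopSpan (Γ : AGraph A V) (v : V) (W : Set (List (A × Bool))) : AGraph A V where
  verts := {q | q = v ∨ ∃ e, Γ.OnLoop v W e ∧ (q = e.1 ∨ q = e.2.2)}
  edges := {e | Γ.OnLoop v W e}
  source_mem e he := Or.inr ⟨e, he, Or.inl rfl⟩
  target_mem e he := Or.inr ⟨e, he, Or.inr rfl⟩

/-- The product graph `Γ ×_A Γ'`. -/
def prod (Γ : AGraph A V) (Γ' : AGraph A V') : AGraph A (V × V') where
  verts := Γ.verts ×ˢ Γ'.verts
  edges := {e | (e.1.1, e.2.1, e.2.2.1) ∈ Γ.edges ∧ (e.1.2, e.2.1, e.2.2.2) ∈ Γ'.edges}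
  source_mem _ he := ⟨Γ.source_mem _ he.1, Γ'.source_mem _ he.2⟩
  target_mem _ he := ⟨Γ.target_mem _ he.1, Γ'.target_mem _ he.2⟩

/-- The connected component of the vertex `v` in `Γ`. -/
def component (Γ : AGraph A V) (v : V) : AGraph A V where
  verts := {q | q ∈ Γ.verts ∧ ∃ w, Γ.IsPath v w q}
  edges := {e | e ∈ Γ.edges ∧ (∃ w, Γ.IsPath v w e.1) ∧ ∃ w, Γ.IsPath v w e.2.2}
  source_mem e he := ⟨Γ.source_mem e he.1, he.2.1⟩
  target_mem e he := ⟨Γ.target_mem e he.1, he.2.2⟩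

/-- The set of elements of the free group whose reduced word labels a loop of `Γ` at `v`. -/
def loopSet [DecidableEq A] (Γ : AGraph A V) (v : V) : Set (FreeGroup A) :=
  {x | Γ.IsPath v x.toWord v}

end AGraph

/-! ### Schreier graphs and Stallings graphs -/

/-- The set of right cosets `H g`. -/
abbrev RightCosets {G : Type*} [Group G] (H : Subgroup G) : Type _ :=
  Quotient (QuotientGroup.rightRel H)

/-- The right coset `H g`. -/
def rightCoset {G : Type*} [Group G] (H : Subgroup G) (g : G) : RightCosets H :=
  Quotient.mk (QuotientGroup.rightRel H) g

/-- The Schreier graph of `H`: its edges are the triples `(H g, a, H g a)`. -/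
def schreierGraph {n : ℕ} {G : Type*} [Group G] (γ : Fin n → G) (H : Subgroup G) :
    AGraph (Fin n) (RightCosets H) where
  verts := Set.univ
  edges := {e | ∃ (g : G) (a : Fin n), e = (rightCoset H g, a, rightCoset H (g * γ a))}
  source_mem _ _ := trivial
  target_mem _ _ := trivial

/-- The Stallings graph of `H` with respect to `L`: the part of the Schreier graph spanned by the
loops at the vertex `H` labeled by the words of `L` that represent elements of `H`. -/
def stallingsGraph {n : ℕ} {G : Type*} [Group G] (γ : Fin n → G) (L : Language (Letter n))
    (H : Subgroup G) : AGraph (Fin n) (RightCosets H) :=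
  (schreierGraph γ H).loopSpan (rightCoset H 1) {w | w ∈ L ∧ evalWord γ w ∈ H}

/-- The component of the product of the Stallings graphs of `H` and `K` that contains the
pair of base vertices. -/
def stallingsProduct {n : ℕ} {G : Type*} [Group G] (γ : Fin n → G) (L : Language (Letter n))
    (H K : Subgroup G) : AGraph (Fin n) (RightCosets H × RightCosets K) :=
  ((stallingsGraph γ L H).prod (stallingsGraph γ L K)).component (rightCoset H 1, rightCoset K 1)

/-!
The Stallings graph `Γ_L(H)` of an `L`-quasi-convex subgroup `H = ⟨h_1, …, h_s⟩` is finite, and a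
finite graph can be certified to be `Γ_L(H)` by data whose verification uses only the automata.
Hence a search through all candidates and certificates finds it, and then generators of the group
of loops in a product of two Stallings graphs are read off. The algorithm is thus the
uniformization (`SemiDec.exists_partrec`) of a recursively enumerable relation `IntersectionCert`
between inputs and outputs. Two things have to be proved: a certified output is correct, and for
the inputs in question a certified output exists. No certificate mentions the group, but each is
meaningful for every group of which the automata form an automatic structure.

*Certificates.* Vertices of finite graphs are words, thought of as names of cosets. Reading words
with the multipliers, starting from any accepted word `u` along `u⁻¹ w`, one obtains the accepted
words for the element of `w` (`IsAutomaticStructure.represents_iff`); so membership in `H` is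
recursively enumerable (`IsAutomaticStructure.inGenerated_iff`). That some implication holds for
all pairs accepted by a multiplier is certified by a finite invariant set of states of a product
automaton (`tracks_iff_exists_tracksInvariant`). A graph `Δ` is certified to be `Γ_L(H)` by three
facts (`StallingsCert`): all accepted words for elements of `H` label loops of `Δ`; all edges of
`Δ` are edges of `Γ_L(H)`; and distinct vertices `p`, `q` are distinct cosets, because an accepted
word for the element of `p q⁻¹` does not label a loop. The first fact is a closure property under right
multiplication by the generators of `H`, which the multipliers can verify letter by letter, in an
auxiliary graph `Γ` large enough for the cosets met on the way (`Saturated.run_eq_of_mem`).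

*Soundness.* From these facts `Δ` and `Γ_L(H)` have the same loops
(`StallingsCert.run_eq_base_iff`). For two such graphs, words assigned to the vertices of the
product as by a spanning tree certify a generating set of the group of loops
(`SpanningCert.closure_eq_loopSet`). It represents a generating set of `H ∩ K`, since an accepted
word for an element of `H ∩ K` labels a loop in both Stallings graphs (`generatedBy_eq_inf`).

*Existence.* The auxiliary graph `Γ` is a ball in the Schreier graph. By quasi-convexity, and by
the fellow traveller property (`IsAutomaticStructure.exists_fellow_travel`), accepted words that
end in a given ball stay in a larger ball (`IsAutomaticStructure.exists_cosetBall`), so all the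
conditions hold once the ball is large enough (`exists_stallingsCert`).
-/

/-! ### Semidecidable predicates -/

-- With these attributes `fun_prop` proves that functions composed of the basic ones are primitive
-- recursive.
attribute [fun_prop] Primrec
attribute [fun_prop] Primrec.id Primrec.const Primrec.comp Primrec.pair

namespace Primrec

variable {α β γ : Type*} [Primcodable α] [Primcodable β] [Primcodable γ]

@[fun_prop]
theorem fst_comp {f : α → β × γ} (hf : Primrec f) : Primrec fun a => (f a).1 := fst.comp hf

@[fun_prop]
theorem snd_comp {f : α → β × γ} (hf : Primrec f) : Primrec fun a => (f a).2 := snd.comp hf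

@[fun_prop]
theorem append_comp {f g : α → List β} (hf : Primrec f) (hg : Primrec g) :
    Primrec fun a => f a ++ g a := list_append.comp hf hg

@[fun_prop]
theorem cons_comp {f : α → β} {g : α → List β} (hf : Primrec f) (hg : Primrec g) :
    Primrec fun a => f a :: g a := list_cons.comp hf hg

@[fun_prop]
theorem some_comp {f : α → β} (hf : Primrec f) : Primrec fun a => some (f a) :=
  option_some.comp hf

@[fun_prop]
theorem flatten_comp {f : α → List (List β)} (hf : Primrec f) :
    Primrec fun a => (f a).flatten := list_flatten.comp hf

end Primrec

/-- A predicate is semidecidable if it is the projection of a primitive recursive relation,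
that is, if it is recursively enumerable. This form makes the closure under existential
quantifiers and under universal quantifiers bounded by lists immediate. -/
def SemiDec {α : Type*} [Primcodable α] (p : α → Prop) : Prop :=
  ∃ q : α → ℕ → Prop, PrimrecRel q ∧ ∀ a, p a ↔ ∃ k, q a k

namespace SemiDec

variable {α β σ : Type*} [Primcodable α] [Primcodable β] [Primcodable σ]

theorem of_primrecPred {p : α → Prop} (hp : PrimrecPred p) : SemiDec p :=
  ⟨fun a _ => p a, PrimrecPred.comp hp Primrec.fst, fun _ => ⟨fun h => ⟨0, h⟩, fun ⟨_, h⟩ => h⟩⟩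

theorem of_iff {p q : α → Prop} (hp : SemiDec p) (h : ∀ a, q a ↔ p a) : SemiDec q := by
  obtain rfl : p = q := funext fun a => propext (h a).symm
  exact hp

theorem eq {f g : α → β} (hf : Primrec f) (hg : Primrec g) : SemiDec fun a => f a = g a :=
  of_primrecPred (Primrec.eq.comp hf hg)

theorem ne {f g : α → β} (hf : Primrec f) (hg : Primrec g) : SemiDec fun a => f a ≠ g a :=
  of_primrecPred (Primrec.eq.comp hf hg).not

theorem comp {p : β → Prop} {f : α → β} (hp : SemiDec p) (hf : Primrec f) :
    SemiDec fun a => p (f a) := by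
  obtain ⟨q, hq, h⟩ := hp
  exact ⟨fun a k => q (f a) k, PrimrecRel.comp hq (hf.comp .fst) .snd, fun a => h (f a)⟩

theorem and {p q : α → Prop} (hp : SemiDec p) (hq : SemiDec q) :
    SemiDec fun a => p a ∧ q a := by
  obtain ⟨p', hp', h₁⟩ := hp
  obtain ⟨q', hq', h₂⟩ := hq
  refine ⟨fun a k => p' a k.unpair.1 ∧ q' a k.unpair.2,
    PrimrecPred.and
      (PrimrecRel.comp hp' .fst (Primrec.fst.comp (Primrec.unpair.comp .snd)))
      (PrimrecRel.comp hq' .fst (Primrec.snd.comp (Primrec.unpair.comp .snd))), fun a => ?_⟩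
  refine (and_congr (h₁ a) (h₂ a)).trans ?_
  constructor
  · rintro ⟨⟨i, hi⟩, j, hj⟩
    exact ⟨Nat.pair i j, by simpa using ⟨hi, hj⟩⟩
  · rintro ⟨k, hi, hj⟩
    exact ⟨⟨_, hi⟩, _, hj⟩

theorem or {p q : α → Prop} (hp : SemiDec p) (hq : SemiDec q) :
    SemiDec fun a => p a ∨ q a := by
  obtain ⟨p', hp', h₁⟩ := hp
  obtain ⟨q', hq', h₂⟩ := hq
  refine ⟨fun a k => p' a k ∨ q' a k, PrimrecPred.or hp' hq', fun a => ?_⟩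
  exact (or_congr (h₁ a) (h₂ a)).trans exists_or.symm

theorem ex {p : α → β → Prop} (hp : SemiDec fun x : α × β => p x.1 x.2) :
    SemiDec fun a => ∃ b, p a b := by
  obtain ⟨q, hq, h⟩ := hp
  have hR : PrimrecRel fun (b : β) (x : α × ℕ) => q (x.1, b) x.2 :=
    PrimrecRel.comp hq ((Primrec.fst.comp .snd).pair .fst) (Primrec.snd.comp .snd)
  refine ⟨fun a k => ∃ b ∈ (Encodable.decode (α := β) k.unpair.1).toList, q (a, b) k.unpair.2,
    hR.exists_mem_list.comp
      (f := fun x : α × ℕ => (Encodable.decode (α := β) x.2.unpair.1).toList)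
      (g := fun x : α × ℕ => (x.1, x.2.unpair.2))
      (Primrec.optionToList.comp
        (Primrec.decode.comp (Primrec.fst.comp (Primrec.unpair.comp .snd))))
      (Primrec.fst.pair (Primrec.snd.comp (Primrec.unpair.comp .snd))), fun a => ?_⟩
  constructor
  · rintro ⟨b, hb⟩
    obtain ⟨k, hk⟩ := (h (a, b)).1 hb
    exact ⟨Nat.pair (Encodable.encode b) k, b, by simp, by simpa using hk⟩
  · rintro ⟨k, b, -, hb⟩
    exact ⟨b, (h (a, b)).2 ⟨_, hb⟩⟩

theorem forall_mem {p : α → β → Prop} {l : α → List β}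
    (hp : SemiDec fun x : α × β => p x.1 x.2) (hl : Primrec l) :
    SemiDec fun a => ∀ b ∈ l a, p a b := by
  obtain ⟨q, hq, h⟩ := hp
  have h₁ : PrimrecRel fun (k : ℕ) (x : β × α) => q (x.2, x.1) k :=
    PrimrecRel.comp hq
      ((Primrec.snd.comp .snd).pair (Primrec.fst.comp .snd)) .fst
  have h₂ : PrimrecRel fun (b : β) (x : α × ℕ) => ∃ k < x.2, q (x.1, b) k :=
    (PrimrecRel.comp h₁.exists_mem_list (f := fun x : β × α × ℕ => List.range x.2.2)
      (g := fun x : β × α × ℕ => (x.1, x.2.1)) (Primrec.list_range.comp (by fun_prop))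
      (by fun_prop)).of_eq fun _ => by simp
  refine ⟨fun a K => ∀ b ∈ l a, ∃ k < K, q (a, b) k,
    h₂.forall_mem_list.comp (hl.comp .fst) .id, fun a => ?_⟩
  beta_reduce
  constructor
  · intro H
    generalize l a = L at H ⊢
    induction L with
    | nil => exact ⟨0, by simp⟩
    | cons b L ih =>
      obtain ⟨K, hK⟩ := ih fun c hc => H c (List.mem_cons_of_mem _ hc)
      obtain ⟨k, hk⟩ := (h (a, b)).1 (H b List.mem_cons_self)
      refine ⟨max K (k + 1), fun c hc => ?_⟩
      rcases List.mem_cons.1 hc with rfl | hc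
      · exact ⟨k, by omega, hk⟩
      · obtain ⟨j, hj, hq⟩ := hK c hc
        exact ⟨j, by omega, hq⟩
  · rintro ⟨K, hK⟩ b hb
    obtain ⟨k, -, hk⟩ := hK b hb
    exact (h (a, b)).2 ⟨k, hk⟩

theorem mem {f : α → β} {l : α → List β} (hf : Primrec f) (hl : Primrec l) :
    SemiDec fun a => f a ∈ l a :=
  of_primrecPred <| (Primrec.eq.exists_mem_list.comp hl hf).of_eq fun _ => by simp

theorem exists_mem {p : α → β → Prop} {l : α → List β}
    (hp : SemiDec fun x : α × β => p x.1 x.2) (hl : Primrec l) :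
    SemiDec fun a => ∃ b ∈ l a, p a b :=
  SemiDec.ex (.and (.mem .snd (hl.comp .fst)) hp)

/-- The certificate for `ReflTransGen` is the list of the points that are passed. -/
theorem reflTransGen {r : α → σ → σ → Prop} {s t : α → σ}
    (hr : SemiDec fun x : α × σ × σ => r x.1 x.2.1 x.2.2) (hs : Primrec s) (ht : Primrec t) :
    SemiDec fun a => Relation.ReflTransGen (r a) (s a) (t a) := by
  have key : SemiDec fun a => ∃ l : List σ,
      (s a :: l)[l.length]? = some (t a) ∧ ∀ i ∈ List.range l.length, ∃ p q,
        ((s a :: l)[i]? = some p ∧ l[i]? = some q) ∧ r a p q := by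
    have hg : ∀ {τ : Type _} [Primcodable τ] {f : τ → List σ} {g : τ → ℕ},
        Primrec f → Primrec g → Primrec fun x => (f x)[g x]? :=
      fun hf hg => Primrec.list_getElem?.comp hf hg
    have hlen : Primrec (List.length : List σ → ℕ) := Primrec.list_length
    refine .ex (.and (.eq (hg (by fun_prop) (by fun_prop)) (by fun_prop)) (.forall_mem (.ex (.ex
      (.and (.and (.eq (hg ?_ ?_) ?_) (.eq (hg ?_ ?_) ?_)) ?_)))
        (Primrec.list_range.comp (by fun_prop))))
    · fun_prop
    · fun_prop
    · fun_prop
    · fun_prop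
    · fun_prop
    · fun_prop
    · exact hr.comp (f := fun x : (((α × List σ) × ℕ) × σ) × σ => (x.1.1.1.1, x.1.2, x.2))
        (by fun_prop)
  refine key.of_iff fun a => ⟨fun h => ?_, ?_⟩
  · obtain ⟨l, hl, hlast⟩ := List.exists_isChain_cons_of_relationReflTransGen h
    rw [List.isChain_iff_getElem] at hl
    refine ⟨l, ?_, fun i hi => ?_⟩
    · rw [← hlast, List.getLast_eq_getElem]
      simp
    · have hi := List.mem_range.1 hi
      exact ⟨(s a :: l)[i]'(by simp; omega), l[i],
        ⟨List.getElem?_eq_getElem _, List.getElem?_eq_getElem _⟩, hl i (by simpa using hi)⟩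
  · rintro ⟨l, hl, hstep⟩
    have main : ∀ i, i ≤ l.length → ∀ p, (s a :: l)[i]? = some p →
        Relation.ReflTransGen (r a) (s a) p := by
      intro i
      induction i with
      | zero =>
        intro _ p hp
        simp only [List.getElem?_cons_zero, Option.some.injEq] at hp
        exact hp ▸ .refl
      | succ i ih =>
        intro hi p hp
        obtain ⟨p', q', ⟨h₁, h₂⟩, h₃⟩ := hstep i (List.mem_range.2 (by omega))
        rw [List.getElem?_cons_succ, h₂, Option.some.injEq] at hp
        exact (ih (by omega) _ h₁).tail (hp ▸ h₃)
    exact main _ le_rfl _ hl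

/-- Uniformization: a semidecidable relation contains the graph of a partial recursive function
with the same domain, obtained by searching for a pair of a value and a certificate. -/
theorem exists_partrec {p : α → β → Prop} (hp : SemiDec fun x : α × β => p x.1 x.2) :
    ∃ f : α →. β, Partrec f ∧ ∀ a, (∃ b, p a b) → ∃ b ∈ f a, p a b := by
  obtain ⟨q, hq, h⟩ := hp
  classical
  let F : α → ℕ → Option β := fun a k =>
    (Encodable.decode (α := β) k.unpair.1).bind fun b =>
      if q (a, b) k.unpair.2 then some b else none
  have hF : Primrec₂ F := by
    refine Primrec.option_bind
      (Primrec.decode.comp (Primrec.fst.comp (Primrec.unpair.comp .snd))) ?_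
    refine Primrec.ite (PrimrecRel.comp hq (f := fun x : (α × ℕ) × β => (x.1.1, x.2))
      (g := fun x : (α × ℕ) × β => x.1.2.unpair.2) (by fun_prop) ?_) (by fun_prop) (by fun_prop)
    exact Primrec.snd.comp (Primrec.unpair.comp (by fun_prop))
  refine ⟨fun a => Nat.rfindOpt (F a), Partrec.rfindOpt hF.to_comp, fun a ⟨b, hb⟩ => ?_⟩
  obtain ⟨k, hk⟩ := (h (a, b)).1 hb
  have hdom : (Nat.rfindOpt (F a)).Dom :=
    Nat.rfindOpt_dom.2 ⟨Nat.pair (Encodable.encode b) k, b, by simp [F, hk]⟩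
  refine ⟨_, Part.get_mem hdom, ?_⟩
  obtain ⟨m, hm⟩ := Nat.rfindOpt_spec (Part.get_mem hdom)
  obtain ⟨c, -, hc⟩ := Option.bind_eq_some_iff.1 hm
  split_ifs at hc with hqc
  · rw [← Option.some.inj hc]
    exact (h (a, c)).2 ⟨_, hqc⟩

end SemiDec

/-! ### Automata given by codes -/

namespace FACode

variable {α : Type} (c : FACode α)

/-- The states that occur in a code as initial states or as targets of transitions. -/
def states : List ℕ := c.1 ++ c.2.1.map fun t => t.2.2

theorem mem_states_of_mem_eval {m : ℕ} {y : List α} (h : m ∈ c.toNFA.eval y) :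
    m ∈ c.states := by
  induction y using List.reverseRecOn with
  | nil => exact List.mem_append_left _ h
  | append_singleton y a =>
    rw [NFA.eval_append_singleton, NFA.mem_stepSet] at h
    obtain ⟨t, -, ht⟩ := h
    exact List.mem_append_right _ (List.mem_map.2 ⟨_, ht, rfl⟩)

theorem append_mem_language_iff {y z : List α} :
    y ++ z ∈ c.language ↔ ∃ m ∈ c.toNFA.eval y, z ∈ c.toNFA.acceptsFrom {m} := by
  rw [FACode.language, NFA.accepts_eq_acceptsFrom_start, NFA.append_mem_acceptsFrom,
    NFA.mem_acceptsFrom]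
  simp only [NFA.mem_evalFrom_iff_exists (S := c.toNFA.evalFrom _ _), NFA.mem_acceptsFrom]
  constructor
  · rintro ⟨s, hs, m, hm, h⟩
    exact ⟨m, hm, s, hs, h⟩
  · rintro ⟨m, hm, s, hs, h⟩
    exact ⟨s, hs, m, hm, h⟩

/-- Every word that can be completed to an accepted word can be so completed by a word of
bounded length, since the automaton has only finitely many states. -/
theorem exists_bounded_completion :
    ∃ N : ℕ, ∀ y z, y ++ z ∈ c.language → ∃ z', z'.length ≤ N ∧ y ++ z' ∈ c.language := by
  have hex : ∀ m, ∃ z', ∀ z, z ∈ c.toNFA.acceptsFrom {m} → z' ∈ c.toNFA.acceptsFrom {m} := by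
    intro m
    by_cases h : ∃ z, z ∈ c.toNFA.acceptsFrom {m}
    · exact ⟨h.choose, fun _ _ => h.choose_spec⟩
    · exact ⟨[], fun z hz => (h ⟨z, hz⟩).elim⟩
  choose f hf using hex
  refine ⟨c.states.toFinset.sup fun m => (f m).length, fun y z h => ?_⟩
  obtain ⟨m, hm, hz⟩ := c.append_mem_language_iff.1 h
  exact ⟨f m, Finset.le_sup (f := fun m => (f m).length)
    (List.mem_toFinset.2 (c.mem_states_of_mem_eval hm)),
    c.append_mem_language_iff.2 ⟨m, hm, hf m z hz⟩⟩

/-- One step of a run: a transition is followed and the letter that it reads is removed. -/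
def RunStep (s t : ℕ × List α) : Prop :=
  ∃ e ∈ c.2.1, (e.1 = s.1 ∧ e.2.2 = t.1) ∧ s.2 = e.2.1 :: t.2

theorem reflTransGen_runStep_iff {s t : ℕ} {y : List α} :
    Relation.ReflTransGen c.RunStep (s, y) (t, []) ↔ t ∈ c.toNFA.evalFrom {s} y := by
  induction y generalizing s with
  | nil =>
    simp only [NFA.evalFrom_nil, Set.mem_singleton_iff]
    constructor
    · intro h
      rcases h.cases_head with h | ⟨_, ⟨_, _, _, h⟩, _⟩
      · exact (Prod.ext_iff.1 h).1.symm
      · simp at h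
    · rintro rfl
      exact .refl
  | cons a y ih =>
    rw [NFA.evalFrom_cons, NFA.stepSet_singleton, NFA.mem_evalFrom_iff_exists]
    constructor
    · intro h
      rcases h.cases_head with h | ⟨⟨m, z⟩, ⟨e, he, ⟨h₁, h₂⟩, h₃⟩, h⟩
      · simp at h
      · obtain ⟨rfl, rfl⟩ := List.cons_eq_cons.1 h₃
        subst h₁ h₂
        exact ⟨_, he, ih.1 h⟩
    · rintro ⟨m, hm, h⟩
      exact .head ⟨(s, a, m), hm, ⟨rfl, rfl⟩, rfl⟩ (ih.2 h)

theorem mem_language_iff {y : List α} : y ∈ c.language ↔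
    ∃ s ∈ c.1, ∃ t ∈ c.2.2, Relation.ReflTransGen c.RunStep (s, y) (t, []) := by
  simp only [reflTransGen_runStep_iff]
  rw [FACode.language, NFA.mem_accepts]
  simp only [NFA.mem_evalFrom_iff_exists (S := c.toNFA.start)]
  constructor
  · rintro ⟨t, ht, s, hs, h⟩
    exact ⟨s, hs, t, ht, h⟩
  · rintro ⟨s, hs, t, ht, h⟩
    exact ⟨t, ht, s, hs, h⟩

end FACode

theorem SemiDec.mem_language {α β : Type} [Primcodable α] [Primcodable β] {c : β → FACode α}
    {y : β → List α} (hc : Primrec c) (hy : Primrec y) :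
    SemiDec fun b => y b ∈ (c b).language := by
  refine .of_iff ?_ fun b => (c b).mem_language_iff
  refine .exists_mem (.exists_mem
    (.reflTransGen (r := fun (x : (β × ℕ) × ℕ) => (c x.1.1).RunStep) ?_ ?_ ?_) ?_) ?_
  · exact .exists_mem (.and (.and (.eq (by fun_prop) (by fun_prop))
      (.eq (by fun_prop) (by fun_prop))) (.eq (by fun_prop) (by fun_prop))) (by fun_prop)
  all_goals fun_prop

/-! ### Finite labeled graphs -/

/-- A finite graph with letters as labels, as a list of edges `((p, x), q)`. The vertices are
named by words, the base vertex by the empty word. -/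
abbrev FinGraph (n : ℕ) : Type := List ((GWord n × Letter n) × GWord n)

namespace FinGraph

variable {n : ℕ} (Γ : FinGraph n)

/-- The vertex reached by reading a letter; `none` stands for having left the graph. -/
def step (s : Option (GWord n)) (x : Letter n) : Option (GWord n) :=
  s.bind fun p => Γ.lookup (p, x)

/-- The vertex reached by reading a word from the base vertex. -/
def run (w : GWord n) : Option (GWord n) := w.foldl Γ.step (some [])

/-- Reading a padded letter: the padding symbol causes no move. -/
def stepPad (s : Option (GWord n)) (x : Option (Letter n)) : Option (GWord n) :=
  x.elim s (Γ.step s)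

@[simp] theorem run_nil : Γ.run [] = some [] := rfl

theorem run_concat (w : GWord n) (x : Letter n) : Γ.run (w ++ [x]) = Γ.step (Γ.run w) x := by
  simp [run]

variable {Γ}

theorem mem_of_step_eq {p q : GWord n} {x : Letter n} (h : Γ.step (some p) x = some q) :
    ((p, x), q) ∈ Γ := by
  obtain ⟨l₁, l₂, rfl, -⟩ := List.lookup_eq_some_iff.1 (show Γ.lookup (p, x) = some q from h)
  simp

theorem exists_step_eq {p q : GWord n} {x : Letter n} (h : ((p, x), q) ∈ Γ) :
    ∃ q', Γ.step (some p) x = some q' := by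
  refine Option.isSome_iff_exists.1 (List.lookup_isSome_iff.2 ⟨_, h, ?_⟩)
  simp

/-- The states of a run are the base vertex, targets of edges, and the state `none`. -/
def runStates (Γ : FinGraph n) : List (Option (GWord n)) :=
  none :: some [] :: Γ.map fun e => some e.2

theorem step_mem_runStates (s : Option (GWord n)) (x : Letter n) : Γ.step s x ∈ Γ.runStates := by
  cases h : Γ.step s x with
  | none => simp [runStates]
  | some q =>
    cases s with
    | none => simp [step] at h
    | some p => exact .tail _ (.tail _ (List.mem_map.2 ⟨_, mem_of_step_eq h, rfl⟩))

theorem run_mem_runStates (w : GWord n) : Γ.run w ∈ Γ.runStates := by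
  induction w using List.reverseRecOn with
  | nil => simp [runStates]
  | append_singleton w x => rw [run_concat]; exact step_mem_runStates _ _

end FinGraph

/-- The first word of a pair that is written as a padded word. -/
abbrev padFst {n : ℕ} (y : List (PadLetter n)) : GWord n := y.filterMap Prod.fst

/-- The second word of a pair that is written as a padded word. -/
abbrev padSnd {n : ℕ} (y : List (PadLetter n)) : GWord n := y.filterMap Prod.snd

theorem FinGraph.run_padFst_concat {n : ℕ} (Γ : FinGraph n) (y : List (PadLetter n))
    (a : PadLetter n) : Γ.run (padFst (y ++ [a])) = Γ.stepPad (Γ.run (padFst y)) a.1 := by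
  obtain ⟨_ | x, b⟩ := a <;> simp [padFst, List.filterMap_append, stepPad, run_concat]

theorem FinGraph.run_padSnd_concat {n : ℕ} (Γ : FinGraph n) (y : List (PadLetter n))
    (a : PadLetter n) : Γ.run (padSnd (y ++ [a])) = Γ.stepPad (Γ.run (padSnd y)) a.2 := by
  obtain ⟨b, _ | x⟩ := a <;> simp [padSnd, List.filterMap_append, stepPad, run_concat]

/-- For every accepted pair `(u, v)`: if `u` leads to `p` in `Γ₁`, then `v` leads to `q` in
`Γ₂`. -/
def Tracks {n : ℕ} (c : FACode (PadLetter n)) (Γ₁ : FinGraph n) (p : GWord n) (Γ₂ : FinGraph n)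
    (q : GWord n) : Prop :=
  ∀ y ∈ c.language, Γ₁.run (padFst y) = some p → Γ₂.run (padSnd y) = some q

/-- A list of states of the product of an automaton and two graphs that contains the reachable
states and shows that `Tracks` holds. -/
def TracksInvariant {n : ℕ} (c : FACode (PadLetter n)) (Γ₁ : FinGraph n) (p : GWord n)
    (Γ₂ : FinGraph n) (q : GWord n) (I : List (ℕ × Option (GWord n) × Option (GWord n))) : Prop :=
  (∀ m ∈ c.1, (m, some [], some []) ∈ I) ∧
  (∀ s ∈ I, ∀ t ∈ c.2.1, s.1 = t.1 →
    (t.2.2, Γ₁.stepPad s.2.1 t.2.1.1, Γ₂.stepPad s.2.2 t.2.1.2) ∈ I) ∧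
  ∀ s ∈ I, ∀ m ∈ c.2.2, s.1 = m → s.2.1 = some p → s.2.2 = some q

/-- The invariant is the set of the reachable states, which is finite since the automaton and the
graphs are. -/
theorem tracks_iff_exists_tracksInvariant {n : ℕ} {c : FACode (PadLetter n)} {Γ₁ Γ₂ : FinGraph n}
    {p q : GWord n} : Tracks c Γ₁ p Γ₂ q ↔ ∃ I, TracksInvariant c Γ₁ p Γ₂ q I := by
  constructor
  · intro h
    let R : Set (ℕ × Option (GWord n) × Option (GWord n)) :=
      {s | ∃ y, s.1 ∈ c.toNFA.eval y ∧ s.2.1 = Γ₁.run (padFst y) ∧ s.2.2 = Γ₂.run (padSnd y)}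
    have hR : R.Finite := by
      refine ((List.finite_toSet c.states).prod ((List.finite_toSet Γ₁.runStates).prod
        (List.finite_toSet Γ₂.runStates))).subset ?_
      rintro ⟨m, s₁, s₂⟩ ⟨y, hm, h₁, h₂⟩
      simp only at h₁ h₂
      exact ⟨c.mem_states_of_mem_eval hm, h₁ ▸ FinGraph.run_mem_runStates _,
        h₂ ▸ FinGraph.run_mem_runStates _⟩
    have hmem : ∀ s, s ∈ hR.toFinset.toList ↔ s ∈ R := by simp
    refine ⟨hR.toFinset.toList, fun m hm => (hmem _).2 ⟨[], hm, rfl, rfl⟩, ?_, ?_⟩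
    · rintro ⟨m, s₁, s₂⟩ hs ⟨t, a, t'⟩ ht he
      obtain ⟨y, hy, h₁, h₂⟩ := (hmem _).1 hs
      simp only at he hy h₁ h₂
      subst he h₁ h₂
      refine (hmem _).2 ⟨y ++ [a], ?_, (Γ₁.run_padFst_concat y a).symm,
        (Γ₂.run_padSnd_concat y a).symm⟩
      rw [NFA.eval_append_singleton, NFA.mem_stepSet]
      exact ⟨m, hy, ht⟩
    · rintro ⟨m, s₁, s₂⟩ hs _ hm rfl hp
      obtain ⟨y, hy, h₁, h₂⟩ := (hmem _).1 hs
      simp only at hy h₁ h₂ hp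
      exact h₂ ▸ h y ⟨m, hm, hy⟩ (h₁ ▸ hp)
  · rintro ⟨I, hI, hstep, hfin⟩ y ⟨m, hm, hy⟩ hp
    have main : ∀ y, ∀ m ∈ c.toNFA.eval y, (m, Γ₁.run (padFst y), Γ₂.run (padSnd y)) ∈ I := by
      intro y
      induction y using List.reverseRecOn with
      | nil => exact fun m hm => hI m hm
      | append_singleton y a ih =>
        intro m hm
        rw [NFA.eval_append_singleton, NFA.mem_stepSet] at hm
        obtain ⟨t, ht, hm⟩ := hm
        rw [Γ₁.run_padFst_concat, Γ₂.run_padSnd_concat]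
        exact hstep _ (ih t ht) _ hm rfl
    exact hfin _ (main y m hy) m hm rfl hp

/-! ### Computability of runs and semidecidability of `Tracks` -/

/-- The letter inverse to a given one. -/
abbrev invLetter {n : ℕ} (x : Letter n) : Letter n := (x.1, !x.2)


namespace Primrec

variable {n : ℕ} {β : Type} [Primcodable β]

@[fun_prop]
theorem finGraph_step {Γ : β → FinGraph n} {s : β → Option (GWord n)} {x : β → Letter n}
    (hΓ : Primrec Γ) (hs : Primrec s) (hx : Primrec x) :
    Primrec fun b => (Γ b).step (s b) (x b) :=
  option_bind hs <| Primrec₂.mk <| listLookup.comp (g := fun y : β × GWord n => (y.2, x y.1))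
    (h := fun y : β × GWord n => Γ y.1) (by fun_prop) (by fun_prop) |>.of_eq fun y => by
      rw [lawful_beq_subsingleton instBEqOfDecidableEq instBEqProd]

@[fun_prop]
theorem finGraph_run {Γ : β → FinGraph n} {w : β → GWord n}
    (hΓ : Primrec Γ) (hw : Primrec w) : Primrec fun b => (Γ b).run (w b) :=
  list_foldl (h := fun b (z : Option (GWord n) × Letter n) => (Γ b).step z.1 z.2) hw
    (const (some [])) (by unfold Primrec₂; fun_prop)

@[fun_prop]
theorem finGraph_stepPad {Γ : β → FinGraph n} {s : β → Option (GWord n)}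
    {x : β → Option (Letter n)} (hΓ : Primrec Γ) (hs : Primrec s) (hx : Primrec x) :
    Primrec fun b => (Γ b).stepPad (s b) (x b) :=
  (option_casesOn (g := fun b a => (Γ b).step (s b) a) hx hs
    (by unfold Primrec₂; fun_prop)).of_eq fun b => by cases x b <;> rfl

@[fun_prop]
theorem padFst_comp {y : β → List (PadLetter n)} (hy : Primrec y) :
    Primrec fun b => padFst (y b) :=
  listFilterMap hy (by unfold Primrec₂; fun_prop)

@[fun_prop]
theorem padSnd_comp {y : β → List (PadLetter n)} (hy : Primrec y) :
    Primrec fun b => padSnd (y b) :=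
  listFilterMap hy (by unfold Primrec₂; fun_prop)

@[fun_prop]
theorem invLetter_comp {x : β → Letter n} (hx : Primrec x) :
    Primrec fun b => invLetter (x b) :=
  (fst.comp hx).pair (Primrec.not.comp (snd.comp hx))

@[fun_prop]
theorem invRev_comp {w : β → GWord n} (hw : Primrec w) :
    Primrec fun b => FreeGroup.invRev (w b) :=
  list_reverse.comp (list_map hw (g := fun _ x => invLetter x) (by unfold Primrec₂; fun_prop))

@[fun_prop]
theorem autData_acceptor {d : β → AutData n} (hd : Primrec d) :
    Primrec fun b => (d b).acceptor := fst.comp hd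

@[fun_prop]
theorem autData_multiplier {d : β → AutData n} {a : β → Option (Letter n)} (hd : Primrec d)
    (ha : Primrec a) : Primrec fun b => (d b).multiplier (a b) := by
  have happ : ∀ {σ : Type} [Primcodable σ] {f : σ → Fin n → FACode (PadLetter n)}
      {g : σ → Fin n}, Primrec f → Primrec g → Primrec fun s => f s (g s) :=
    fun hf hg => fin_app.comp hf hg
  refine (option_casesOn (g := fun b x => bif x.2 then (d b).2.2.1 x.1 else (d b).2.2.2 x.1) ha
    (f := fun b => (d b).2.1) (by fun_prop) ?_).of_eq fun b => ?_
  · exact cond (by fun_prop) (happ (by fun_prop) (by fun_prop))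
      (happ (by fun_prop) (by fun_prop))
  · rcases a b with _ | ⟨i, _ | _⟩ <;> rfl

end Primrec

theorem SemiDec.eq_imp {α β : Type*} [Primcodable α] [Primcodable β] {f g : α → β}
    {p : α → Prop} (hf : Primrec f) (hg : Primrec g) (hp : SemiDec p) :
    SemiDec fun a => f a = g a → p a :=
  (SemiDec.or (.ne hf hg) hp).of_iff fun a => by
    by_cases h : f a = g a <;> simp [h]

theorem SemiDec.tracks {n : ℕ} {β : Type} [Primcodable β] {c : β → FACode (PadLetter n)}
    {Γ₁ Γ₂ : β → FinGraph n} {p q : β → GWord n} (hc : Primrec c) (h₁ : Primrec Γ₁)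
    (hp : Primrec p) (h₂ : Primrec Γ₂) (hq : Primrec q) :
    SemiDec fun b => Tracks (c b) (Γ₁ b) (p b) (Γ₂ b) (q b) := by
  refine .of_iff ?_ fun b => tracks_iff_exists_tracksInvariant
  refine .ex (.and (.forall_mem (.mem ?_ ?_) ?_) (.and
    (.forall_mem (.forall_mem (.eq_imp ?_ ?_ (.mem ?_ ?_)) ?_) ?_)
    (.forall_mem (.forall_mem (.eq_imp ?_ ?_ (.eq_imp ?_ ?_ (.eq ?_ ?_))) ?_) ?_)))
  all_goals fun_prop

/-! ### Words in a group with an automatic structure -/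

section Words

variable {n : ℕ} {G : Type*} [Group G] (γ : Fin n → G)

@[simp] theorem evalWord_nil : evalWord γ [] = 1 := by
  simp [evalWord, ← FreeGroup.one_eq_mk]

@[simp] theorem evalWord_append (u v : GWord n) :
    evalWord γ (u ++ v) = evalWord γ u * evalWord γ v := by
  simp [evalWord, ← FreeGroup.mul_mk]

@[simp] theorem evalWord_invRev (u : GWord n) :
    evalWord γ (FreeGroup.invRev u) = (evalWord γ u)⁻¹ := by
  rw [evalWord, ← FreeGroup.inv_mk, map_inv, evalWord]

theorem evalWord_cons (x : Letter n) (u : GWord n) :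
    evalWord γ (x :: u) = evalWord γ [x] * evalWord γ u :=
  evalWord_append γ [x] u

theorem evalWord_invLetter (x : Letter n) : evalWord γ [invLetter x] = (evalWord γ [x])⁻¹ :=
  evalWord_invRev γ [x]

theorem evalWord_mem_generatedBy {hs : List (GWord n)} {h : GWord n} (hh : h ∈ hs) :
    evalWord γ h ∈ generatedBy γ hs :=
  Subgroup.subset_closure ⟨h, hh, rfl⟩

theorem evalWord_flatten_mem_generatedBy {hs zs : List (GWord n)}
    (h : ∀ z ∈ zs, z ∈ hs ∨ FreeGroup.invRev z ∈ hs) :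
    evalWord γ zs.flatten ∈ generatedBy γ hs := by
  induction zs with
  | nil => simp [one_mem]
  | cons z zs ih =>
    rw [List.flatten_cons, evalWord_append]
    refine mul_mem ?_ (ih fun y hy => h y (List.mem_cons_of_mem _ hy))
    rcases h z List.mem_cons_self with hz | hz
    · exact evalWord_mem_generatedBy γ hz
    · simpa using evalWord_mem_generatedBy γ hz

theorem exists_flatten_of_mem_generatedBy {hs : List (GWord n)} {g : G}
    (hg : g ∈ generatedBy γ hs) :
    ∃ zs : List (GWord n), (∀ z ∈ zs, z ∈ hs ∨ FreeGroup.invRev z ∈ hs) ∧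
      evalWord γ zs.flatten = g := by
  rw [generatedBy, ← Subgroup.mem_toSubmonoid, Subgroup.closure_toSubmonoid] at hg
  obtain ⟨l, hl, rfl⟩ := Submonoid.exists_list_of_mem_closure hg
  clear hg
  induction l with
  | nil => exact ⟨[], by simp⟩
  | cons y l ih =>
    obtain ⟨zs, hzs, he⟩ := ih fun y hy => hl y (List.mem_cons_of_mem _ hy)
    obtain ⟨z, hz, hy⟩ : ∃ z, (z ∈ hs ∨ FreeGroup.invRev z ∈ hs) ∧ evalWord γ z = y := by
      rcases hl y List.mem_cons_self with ⟨z, hz, rfl⟩ | ⟨z, hz, h⟩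
      · exact ⟨z, .inl hz, rfl⟩
      · exact ⟨FreeGroup.invRev z, .inr (by simpa using hz), by simp [h]⟩
    refine ⟨z :: zs, ?_, by simp [he, hy]⟩
    simpa using ⟨hz, hzs⟩

end Words

section Padding

variable {n : ℕ}

theorem padFst_append (y z : List (PadLetter n)) : padFst (y ++ z) = padFst y ++ padFst z :=
  List.filterMap_append

theorem padSnd_append (y z : List (PadLetter n)) : padSnd (y ++ z) = padSnd y ++ padSnd z :=
  List.filterMap_append

@[simp] theorem padFst_padPair (u v : GWord n) : padFst (padPair u v) = u := by
  induction u generalizing v with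
  | nil => cases v <;> simp [padPair, padFst, List.filterMap_map]
  | cons x u ih =>
    cases v with
    | nil => simp [padPair, padFst, List.filterMap_map]
    | cons y v => simpa [padPair, padFst] using ih v

@[simp] theorem padSnd_padPair (u v : GWord n) : padSnd (padPair u v) = v := by
  induction v generalizing u with
  | nil => cases u <;> simp [padPair, padSnd, List.filterMap_map]
  | cons y v ih =>
    cases u with
    | nil => simp [padPair, padSnd, List.filterMap_map]
    | cons x u => simpa [padPair, padSnd] using ih u

theorem take_padPair (u v : GWord n) (i : ℕ) :
    (padPair u v).take i = padPair (u.take i) (v.take i) := by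
  induction i generalizing u v with
  | zero => simp [padPair]
  | succ i ih =>
    cases u with
    | nil => cases v <;> simp [padPair, List.map_take]
    | cons x u =>
      cases v with
      | nil => simp [padPair, List.map_take]
      | cons y v => simpa [padPair] using ih u v

/-- The multiplier for `a` accepts the pair `(u, v)`. -/
def MultRel (d : AutData n) (a : Option (Letter n)) (u v : GWord n) : Prop :=
  ∃ y ∈ (d.multiplier a).language, padFst y = u ∧ padSnd y = v

/-- From a representative of an element, one of its product with the first letter of a word is
found, and this letter is removed. -/
def RepStep (d : AutData n) (s t : GWord n × GWord n) : Prop :=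
  ∃ x, s.2 = x :: t.2 ∧ MultRel d (some x) s.1 t.1

/-- The multipliers show that `v` is an accepted word that represents the same element as `w`:
starting from any accepted word `u`, they lead along the word `u⁻¹ w` to `v`. -/
def Represents (d : AutData n) (w v : GWord n) : Prop :=
  ∃ u, u ∈ d.language ∧ ∃ v',
    Relation.ReflTransGen (RepStep d) (u, FreeGroup.invRev u ++ w) (v', []) ∧ MultRel d none v' v

/-- The word `w` and a product of the words `hs` and their inverses have a common representative
in the accepted language. -/
def InGenerated (d : AutData n) (hs : List (GWord n)) (w : GWord n) : Prop :=
  ∃ zs : List (GWord n), (∀ z ∈ zs, z ∈ hs ∨ FreeGroup.invRev z ∈ hs) ∧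
    ∃ v, Represents d zs.flatten v ∧ Represents d w v

end Padding

namespace IsAutomaticStructure

variable {n : ℕ} {G : Type*} [Group G] {γ : Fin n → G} {d : AutData n}

theorem multRel_iff (h : IsAutomaticStructure γ d) {a : Option (Letter n)} {u v : GWord n} :
    MultRel d a u v ↔
      u ∈ d.language ∧ v ∈ d.language ∧ evalWord γ (u ++ a.toList) = evalWord γ v := by
  constructor
  · rintro ⟨y, hy, hu, hv⟩
    obtain ⟨u', hu', v', hv', he, rfl⟩ := (h.2 a y).1 hy
    rw [padFst_padPair] at hu
    rw [padSnd_padPair] at hv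
    subst hu hv
    exact ⟨hu', hv', he⟩
  · rintro ⟨hu, hv, he⟩
    exact ⟨padPair u v, (h.2 a _).2 ⟨u, hu, v, hv, he, rfl⟩, by simp, by simp⟩

theorem tracks_iff (h : IsAutomaticStructure γ d) {a : Option (Letter n)} {Γ₁ Γ₂ : FinGraph n}
    {p q : GWord n} : Tracks (d.multiplier a) Γ₁ p Γ₂ q ↔
      ∀ u ∈ d.language, ∀ v ∈ d.language, evalWord γ (u ++ a.toList) = evalWord γ v →
        Γ₁.run u = some p → Γ₂.run v = some q := by
  constructor
  · intro H u hu v hv he hp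
    obtain ⟨y, hy, rfl, rfl⟩ := h.multRel_iff.2 ⟨hu, hv, he⟩
    exact H y hy hp
  · intro H y hy
    obtain ⟨hu, hv, he⟩ := h.multRel_iff.1 ⟨y, hy, rfl, rfl⟩
    exact H _ hu _ hv he

theorem represents_iff (h : IsAutomaticStructure γ d) {w v : GWord n} :
    Represents d w v ↔ v ∈ d.language ∧ evalWord γ v = evalWord γ w := by
  constructor
  · rintro ⟨u, hu, v', hc, hm⟩
    obtain ⟨-, hv, he⟩ := h.multRel_iff.1 hm
    have main : ∀ s : GWord n × GWord n, Relation.ReflTransGen (RepStep d) s (v', []) →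
        evalWord γ v' = evalWord γ s.1 * evalWord γ s.2 := by
      intro s hs
      induction hs using Relation.ReflTransGen.head_induction_on with
      | refl => simp
      | head hst _ ih =>
        obtain ⟨x, hx, hm⟩ := hst
        rw [ih, hx, evalWord_cons γ x, ← mul_assoc, ← (h.multRel_iff.1 hm).2.2,
          Option.toList_some, evalWord_append]
    refine ⟨hv, ?_⟩
    have := main _ hc
    simp only [evalWord_append, evalWord_invRev, mul_inv_cancel_left, Option.toList_none,
      evalWord_nil, mul_one] at this he
    rw [← he, this]
  · rintro ⟨hv, he⟩
    have main : ∀ w : GWord n, ∀ u ∈ d.language, ∃ v' ∈ d.language,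
        evalWord γ v' = evalWord γ u * evalWord γ w ∧
          Relation.ReflTransGen (RepStep d) (u, w) (v', []) := by
      intro w
      induction w with
      | nil => exact fun u hu => ⟨u, hu, by simp, .refl⟩
      | cons x w ih =>
        intro u hu
        obtain ⟨u', hu', he'⟩ := h.1 (evalWord γ (u ++ [x]))
        obtain ⟨v', hv', hve, hc⟩ := ih u' hu'
        refine ⟨v', hv', ?_, .head (b := (u', w))
          ⟨x, rfl, h.multRel_iff.2 ⟨hu, hu', he'.symm⟩⟩ hc⟩
        rw [hve, he', evalWord_append, evalWord_cons γ x w, mul_assoc]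
    obtain ⟨v', hv', hve, hc⟩ := main (FreeGroup.invRev v ++ w) v hv
    refine ⟨v, hv, v', hc, h.multRel_iff.2 ⟨hv', hv, ?_⟩⟩
    simp [hve, he]

theorem inGenerated_iff (h : IsAutomaticStructure γ d) {hs : List (GWord n)} {w : GWord n} :
    InGenerated d hs w ↔ evalWord γ w ∈ generatedBy γ hs := by
  constructor
  · rintro ⟨zs, hzs, v, hv, hw⟩
    rw [← (h.represents_iff.1 hw).2, (h.represents_iff.1 hv).2]
    exact evalWord_flatten_mem_generatedBy γ hzs
  · intro hw
    obtain ⟨zs, hzs, he⟩ := exists_flatten_of_mem_generatedBy γ hw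
    obtain ⟨v, hv, hve⟩ := h.1 (evalWord γ w)
    exact ⟨zs, hzs, v, h.represents_iff.2 ⟨hv, by rw [hve, he]⟩, h.represents_iff.2 ⟨hv, hve⟩⟩

/-- The fellow traveller property: if the accepted words `u` and `v` represent elements that
differ by at most one letter on the right, then every prefix of `v` is close to a prefix of `u`.
The reason is that the two prefixes of the same length can be completed in boundedly many steps
to another pair accepted by the multiplier. -/
theorem exists_fellow_travel (h : IsAutomaticStructure γ d) (a : Option (Letter n)) :
    ∃ N : ℕ, ∀ u ∈ d.language, ∀ v ∈ d.language, evalWord γ (u ++ a.toList) = evalWord γ v →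
      ∀ p, p <+: v → ∃ p', p' <+: u ∧ ∃ z : GWord n, z.length ≤ N ∧
        evalWord γ p = evalWord γ p' * evalWord γ z := by
  obtain ⟨N, hN⟩ := (d.multiplier a).exists_bounded_completion
  refine ⟨N + (a.toList.length + N), fun u hu v hv he p hp => ?_⟩
  have hy := (h.2 a (padPair u v)).2 ⟨u, hu, v, hv, he, rfl⟩
  rw [← List.take_append_drop p.length (padPair u v)] at hy
  obtain ⟨y, hyN, hy⟩ := hN _ _ hy
  obtain ⟨-, -, he'⟩ := h.multRel_iff.1 ⟨_, hy, rfl, rfl⟩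
  rw [padFst_append, padSnd_append, take_padPair, padFst_padPair, padSnd_padPair,
    ← List.prefix_iff_eq_take.1 hp] at he'
  refine ⟨u.take p.length, List.take_prefix _ _,
    padFst y ++ (a.toList ++ FreeGroup.invRev (padSnd y)), ?_, ?_⟩
  · have h₁ : (padFst y).length ≤ y.length := List.length_filterMap_le _ _
    have h₂ : (padSnd y).length ≤ y.length := List.length_filterMap_le _ _
    simp only [List.length_append, FreeGroup.invRev_length]
    omega
  · simp only [evalWord_append, evalWord_invRev] at he' ⊢
    rw [← mul_assoc, ← mul_assoc, he', mul_inv_cancel_right]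

end IsAutomaticStructure

namespace SemiDec

variable {n : ℕ} {β : Type} [Primcodable β]

theorem multRel {d : β → AutData n} {a : β → Option (Letter n)} {u v : β → GWord n}
    (hd : Primrec d) (ha : Primrec a) (hu : Primrec u) (hv : Primrec v) :
    SemiDec fun b => MultRel (d b) (a b) (u b) (v b) := by
  refine .ex (.and (.mem_language ?_ ?_) (.and (.eq ?_ ?_) (.eq ?_ ?_)))
  all_goals fun_prop

theorem mem_autData_language {d : β → AutData n} {w : β → GWord n} (hd : Primrec d)
    (hw : Primrec w) : SemiDec fun b => w b ∈ (d b).language :=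
  .mem_language (c := fun b => (d b).acceptor) (by fun_prop) hw

theorem represents {d : β → AutData n} {w v : β → GWord n} (hd : Primrec d) (hw : Primrec w)
    (hv : Primrec v) : SemiDec fun b => Represents (d b) (w b) (v b) := by
  refine .ex (.and (.mem_autData_language ?_ ?_) (.ex (.and
    (.reflTransGen (r := fun (x : (β × GWord n) × GWord n) => RepStep (d x.1.1)) ?_ ?_ ?_)
    (.multRel ?_ ?_ ?_ ?_))))
  case refine_3 =>
    refine .ex (.and (.eq ?_ ?_) (.multRel ?_ ?_ ?_ ?_))
    all_goals fun_prop
  all_goals fun_prop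

theorem inGenerated {d : β → AutData n} {hs : β → List (GWord n)} {w : β → GWord n}
    (hd : Primrec d) (hhs : Primrec hs) (hw : Primrec w) :
    SemiDec fun b => InGenerated (d b) (hs b) (w b) := by
  refine .ex (.and (.forall_mem (.or (.mem ?_ ?_) (.mem ?_ ?_)) ?_)
    (.ex (.and (.represents ?_ ?_ ?_) (.represents ?_ ?_ ?_))))
  all_goals fun_prop

end SemiDec

/-! ### Paths in labeled graphs -/

namespace AGraph

variable {A V V' : Type*} {Γ Δ : AGraph A V} {Γ' : AGraph A V'}

theorem traversed_not (p : V) (x : A × Bool) (q : V) :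
    traversed q (x.1, !x.2) p = traversed p x q := by
  obtain ⟨a, _ | _⟩ := x <;> simp [traversed]

theorem traversed_eq_traversed {p q p' q' : V} {x y : A × Bool}
    (h : traversed p' y q' = traversed p x q) :
    (y = x ∧ p' = p ∧ q' = q) ∨ (y = (x.1, !x.2) ∧ p' = q ∧ q' = p) := by
  obtain ⟨a, _ | _⟩ := x <;> obtain ⟨b, _ | _⟩ := y <;> simp_all [traversed]

theorem isPath_append {p q : V} {u v : List (A × Bool)} :
    Γ.IsPath p (u ++ v) q ↔ ∃ r, Γ.IsPath p u r ∧ Γ.IsPath r v q := by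
  induction u generalizing p with
  | nil => simp [IsPath]
  | cons x u ih =>
    simp only [List.cons_append, IsPath, ih]
    constructor
    · rintro ⟨s, hs, r, h₁, h₂⟩
      exact ⟨r, ⟨s, hs, h₁⟩, h₂⟩
    · rintro ⟨r, ⟨s, hs, h₁⟩, h₂⟩
      exact ⟨s, hs, r, h₁, h₂⟩

theorem isPath_singleton {p q : V} {x : A × Bool} :
    Γ.IsPath p [x] q ↔ traversed p x q ∈ Γ.edges := by
  simp [IsPath]

theorem IsPath.invRev {p q : V} {w : List (A × Bool)} (h : Γ.IsPath p w q) :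
    Γ.IsPath q (FreeGroup.invRev w) p := by
  induction w generalizing p with
  | nil => exact Eq.symm h
  | cons x w ih =>
    obtain ⟨r, hr, h⟩ := h
    have : FreeGroup.invRev (x :: w) = FreeGroup.invRev w ++ [(x.1, !x.2)] := by
      simp [FreeGroup.invRev]
    rw [this, isPath_append]
    exact ⟨r, ih h, isPath_singleton.2 (by rwa [traversed_not])⟩

theorem IsPath.mono (hle : Γ.edges ⊆ Δ.edges) {p q : V} {w : List (A × Bool)}
    (h : Γ.IsPath p w q) : Δ.IsPath p w q := by
  induction w generalizing p with
  | nil => exact h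
  | cons x w ih =>
    obtain ⟨r, hr, h⟩ := h
    exact ⟨r, hle hr, ih h⟩

theorem isPath_prod {p q : V} {p' q' : V'} {w : List (A × Bool)} :
    (Γ.prod Γ').IsPath (p, p') w (q, q') ↔ Γ.IsPath p w q ∧ Γ'.IsPath p' w q' := by
  induction w generalizing p p' with
  | nil => simp [IsPath]
  | cons x w ih =>
    have key : ∀ r r', traversed (p, p') x (r, r') ∈ (Γ.prod Γ').edges ↔
        traversed p x r ∈ Γ.edges ∧ traversed p' x r' ∈ Γ'.edges := by
      intro r r'
      obtain ⟨a, _ | _⟩ := x <;> simp [traversed, prod]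
    simp only [IsPath, Prod.exists, key, ih]
    constructor
    · rintro ⟨r, r', ⟨h₁, h₂⟩, h₃, h₄⟩
      exact ⟨⟨r, h₁, h₃⟩, r', h₂, h₄⟩
    · rintro ⟨⟨r, h₁, h₃⟩, r', h₂, h₄⟩
      exact ⟨r, r', ⟨h₁, h₂⟩, h₃, h₄⟩

theorem isPath_component {v q : V} {w : List (A × Bool)} :
    (Γ.component v).IsPath v w q ↔ Γ.IsPath v w q := by
  have hle : (Γ.component v).edges ⊆ Γ.edges := fun _ he => he.1
  refine ⟨IsPath.mono hle, fun h => ?_⟩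
  suffices H : ∀ p, (∃ u, Γ.IsPath v u p) → Γ.IsPath p w q → (Γ.component v).IsPath p w q from
    H v ⟨[], rfl⟩ h
  clear h
  induction w with
  | nil => exact fun p _ h => h
  | cons x w ih =>
    rintro p ⟨u, hu⟩ ⟨r, hr, h⟩
    have hr' : ∃ u, Γ.IsPath v u r :=
      ⟨u ++ [x], isPath_append.2 ⟨p, hu, isPath_singleton.2 hr⟩⟩
    refine ⟨r, ⟨hr, ?_⟩, ih r hr' h⟩
    obtain ⟨a, _ | _⟩ := x
    · exact ⟨hr', u, hu⟩
    · exact ⟨⟨u, hu⟩, hr'⟩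

/-- A graph is folded if a path is determined by its origin and its label. -/
def Folded (Γ : AGraph A V) : Prop :=
  ∀ p x q q', traversed p x q ∈ Γ.edges → traversed p x q' ∈ Γ.edges → q = q'

theorem Folded.mono (hΔ : Δ.Folded) (hle : Γ.edges ⊆ Δ.edges) : Γ.Folded :=
  fun p x q q' h h' => hΔ p x q q' (hle h) (hle h')

theorem Folded.isPath_unique (hΓ : Γ.Folded) {p q q' : V} {w : List (A × Bool)}
    (h : Γ.IsPath p w q) (h' : Γ.IsPath p w q') : q = q' := by
  induction w generalizing p with
  | nil => exact Eq.trans (Eq.symm h) h'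
  | cons x w ih =>
    obtain ⟨r, hr, h⟩ := h
    obtain ⟨r', hr', h'⟩ := h'
    obtain rfl := hΓ _ _ _ _ hr hr'
    exact ih h h'

theorem Folded.prod (hΓ : Γ.Folded) (hΓ' : Γ'.Folded) : (Γ.prod Γ').Folded := by
  rintro ⟨p, p'⟩ x ⟨q, q'⟩ ⟨r, r'⟩ h h'
  rw [← isPath_singleton, isPath_prod] at h h'
  rw [hΓ.isPath_unique h.1 h'.1, hΓ'.isPath_unique h.2 h'.2]

theorem Folded.isPath_of_red (hΓ : Γ.Folded) {p q : V} {w w' : List (A × Bool)}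
    (hr : FreeGroup.Red w w') (h : Γ.IsPath p w q) : Γ.IsPath p w' q := by
  induction hr with
  | refl => exact h
  | tail _ hs ih =>
    obtain ⟨⟩ := hs
    rw [isPath_append] at ih ⊢
    obtain ⟨r, h₁, s, hs, t, ht, h₂⟩ := ih
    rw [← traversed_not] at hs
    obtain rfl := hΓ _ _ _ _ hs ht
    exact ⟨r, h₁, h₂⟩

variable [DecidableEq A]

/-- The elements whose reduced words label loops of a folded graph form a subgroup. -/
def Folded.loopSubgroup (hΓ : Γ.Folded) (v : V) : Subgroup (FreeGroup A) where
  carrier := Γ.loopSet v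
  one_mem' := by simp [loopSet, IsPath]
  mul_mem' {x y} hx hy := by
    simp only [loopSet, Set.mem_ofPred_eq, FreeGroup.toWord_mul]
    exact hΓ.isPath_of_red FreeGroup.reduce.red (isPath_append.2 ⟨v, hx, hy⟩)
  inv_mem' {x} hx := by
    simp only [loopSet, Set.mem_ofPred_eq, FreeGroup.toWord_inv]
    exact IsPath.invRev hx

theorem Folded.mk_mem_loopSet (hΓ : Γ.Folded) {v : V} {w : List (A × Bool)}
    (h : Γ.IsPath v w v) : FreeGroup.mk w ∈ Γ.loopSet v := by
  simp only [loopSet, Set.mem_ofPred_eq, FreeGroup.toWord_mk]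
  exact hΓ.isPath_of_red FreeGroup.reduce.red h

theorem Folded.closure_subset_loopSet (hΓ : Γ.Folded) {v : V} {ws : List (List (A × Bool))}
    (h : ∀ w ∈ ws, Γ.IsPath v w v) :
    (Subgroup.closure {x : FreeGroup A | ∃ w ∈ ws, FreeGroup.mk w = x} : Set (FreeGroup A)) ⊆
      Γ.loopSet v := by
  have : Subgroup.closure {x : FreeGroup A | ∃ w ∈ ws, FreeGroup.mk w = x} ≤
      hΓ.loopSubgroup v := by
    rw [Subgroup.closure_le]
    rintro _ ⟨w, hw, rfl⟩
    exact hΓ.mk_mem_loopSet (h w hw)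
  exact this

end AGraph

/-! ### Schreier graphs and Stallings graphs -/

section Schreier

variable {n : ℕ} {G : Type*} [Group G] (γ : Fin n → G) (H : Subgroup G)

/-- The coset of `H` that is reached from `H` by reading a word in the Schreier graph. -/
def wordCoset (w : GWord n) : RightCosets H := rightCoset H (evalWord γ w)

variable {γ H}

theorem rightCoset_eq_rightCoset_iff {g g' : G} :
    rightCoset H g = rightCoset H g' ↔ g * g'⁻¹ ∈ H := by
  rw [rightCoset, rightCoset, eq_comm, Quotient.eq, QuotientGroup.rightRel_apply]

theorem wordCoset_nil : wordCoset γ H [] = rightCoset H 1 := by simp [wordCoset]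

theorem wordCoset_eq_iff {w w' : GWord n} :
    wordCoset γ H w = wordCoset γ H w' ↔ evalWord γ (w ++ FreeGroup.invRev w') ∈ H := by
  simp [wordCoset, rightCoset_eq_rightCoset_iff]

theorem wordCoset_eq_base_iff {w : GWord n} :
    wordCoset γ H w = wordCoset γ H [] ↔ evalWord γ w ∈ H := by
  simp [wordCoset_eq_iff, FreeGroup.invRev]

theorem wordCoset_append_congr {w w' : GWord n} (h : wordCoset γ H w = wordCoset γ H w')
    (v : GWord n) : wordCoset γ H (w ++ v) = wordCoset γ H (w' ++ v) := by
  rw [wordCoset_eq_iff] at h ⊢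
  simpa [mul_assoc] using h

theorem wordCoset_append_invLetter (w : GWord n) (x : Letter n) :
    wordCoset γ H (w ++ [x] ++ [invLetter x]) = wordCoset γ H w := by
  rw [wordCoset, evalWord_append, evalWord_append, evalWord_invLetter, mul_inv_cancel_right,
    wordCoset]

theorem traversed_mem_schreierGraph {w : GWord n} {x : Letter n} {c : RightCosets H} :
    AGraph.traversed (wordCoset γ H w) x c ∈ (schreierGraph γ H).edges ↔
      c = wordCoset γ H (w ++ [x]) := by
  obtain ⟨a, _ | _⟩ := x
  · have ha : evalWord γ [(a, false)] = (γ a)⁻¹ := by simp [evalWord]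
    simp only [AGraph.traversed, schreierGraph, Set.mem_ofPred_eq, Bool.false_eq_true, if_false,
      Prod.mk.injEq, wordCoset, evalWord_append, ha]
    constructor
    · rintro ⟨g, _, rfl, rfl, h⟩
      rw [rightCoset_eq_rightCoset_iff] at h ⊢
      rw [← inv_mem_iff]
      simpa [mul_assoc] using h
    · rintro rfl
      exact ⟨_, a, rfl, rfl, by simp⟩
  · have ha : evalWord γ [(a, true)] = γ a := by simp [evalWord]
    simp only [AGraph.traversed, schreierGraph, Set.mem_ofPred_eq, if_true,
      Prod.mk.injEq, wordCoset, evalWord_append, ha]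
    constructor
    · rintro ⟨g, _, h, rfl, rfl⟩
      rw [rightCoset_eq_rightCoset_iff] at h ⊢
      rw [← inv_mem_iff]
      simpa [mul_assoc] using h
    · rintro rfl
      exact ⟨_, a, rfl, rfl, rfl⟩

theorem isPath_schreierGraph {u w : GWord n} {c : RightCosets H} :
    (schreierGraph γ H).IsPath (wordCoset γ H u) w c ↔ c = wordCoset γ H (u ++ w) := by
  induction w generalizing u with
  | nil => simp [AGraph.IsPath, eq_comm]
  | cons x w ih => simp [AGraph.IsPath, traversed_mem_schreierGraph, ih]

variable {L : Language (Letter n)}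

theorem stallingsGraph_edges_subset :
    (stallingsGraph γ L H).edges ⊆ (schreierGraph γ H).edges := fun _ he => he.1

theorem eq_wordCoset_of_isPath_stallingsGraph {w : GWord n} {c : RightCosets H}
    (h : (stallingsGraph γ L H).IsPath (wordCoset γ H []) w c) : c = wordCoset γ H w :=
  isPath_schreierGraph.1 (h.mono stallingsGraph_edges_subset)

/-- The edges of the Stallings graph are those traversed, in one direction or the other, by an
accepted word that represents an element of `H`. -/
theorem traversed_mem_stallingsGraph {p : GWord n} {x : Letter n} {c : RightCosets H} :
    AGraph.traversed (wordCoset γ H p) x c ∈ (stallingsGraph γ L H).edges ↔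
      c = wordCoset γ H (p ++ [x]) ∧ ∃ u y v, u ++ y :: v ∈ L ∧ evalWord γ (u ++ y :: v) ∈ H ∧
        ((y = x ∧ wordCoset γ H u = wordCoset γ H p) ∨
          (y = invLetter x ∧ wordCoset γ H u = wordCoset γ H (p ++ [x]))) := by
  constructor
  · rintro ⟨he, u, y, v, p', q', ⟨hL, hH⟩, hu, ht, -⟩
    rw [traversed_mem_schreierGraph] at he
    rw [← wordCoset_nil (γ := γ), isPath_schreierGraph, List.nil_append] at hu
    refine ⟨he, u, y, v, hL, hH, ?_⟩
    rcases AGraph.traversed_eq_traversed ht with ⟨rfl, h, -⟩ | ⟨rfl, h, -⟩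
    · exact .inl ⟨rfl, by rw [← hu, h]⟩
    · exact .inr ⟨rfl, by rw [← hu, h, he]⟩
  · rintro ⟨rfl, u, y, v, hL, hH, h⟩
    refine ⟨traversed_mem_schreierGraph.2 rfl, u, y, v, wordCoset γ H u,
      wordCoset γ H (u ++ [y]), ⟨hL, hH⟩, ?_, ?_, ?_⟩
    · rw [← wordCoset_nil (γ := γ), isPath_schreierGraph, List.nil_append]
    · rcases h with ⟨rfl, h⟩ | ⟨rfl, h⟩
      · rw [h, wordCoset_append_congr h]
      · rw [wordCoset_append_congr h, wordCoset_append_invLetter, h, AGraph.traversed_not]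
    · rw [isPath_schreierGraph, ← wordCoset_nil (γ := γ), eq_comm, List.append_assoc]
      exact wordCoset_eq_base_iff.2 hH

theorem isPath_stallingsGraph_of_prefix {w u : GWord n} (hL : w ∈ L) (hH : evalWord γ w ∈ H)
    (hu : u <+: w) :
    (stallingsGraph γ L H).IsPath (wordCoset γ H []) u (wordCoset γ H u) := by
  induction u using List.reverseRecOn with
  | nil => exact rfl
  | append_singleton u y ih =>
    obtain ⟨v, rfl⟩ := hu
    refine AGraph.isPath_append.2 ⟨_, ih ⟨y :: v, by simp⟩, AGraph.isPath_singleton.2 ?_⟩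
    rw [List.append_assoc] at hL hH
    exact traversed_mem_stallingsGraph.2 ⟨rfl, u, y, v, hL, hH, .inl ⟨rfl, rfl⟩⟩

theorem folded_stallingsGraph (hγ : ∀ g, ∃ w, evalWord γ w = g) :
    (stallingsGraph γ L H).Folded := by
  refine AGraph.Folded.mono (Δ := schreierGraph γ H) ?_ stallingsGraph_edges_subset
  intro p x q q' h h'
  obtain ⟨g, rfl⟩ := Quotient.exists_rep p
  obtain ⟨w, rfl⟩ := hγ g
  exact (traversed_mem_schreierGraph.1 h).trans (traversed_mem_schreierGraph.1 h').symm

end Schreier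

/-! ### Certificates for Stallings graphs -/

section Certificate

variable {n : ℕ}

/-- The part of a certificate that shows that every accepted word that represents an element of
`H = ⟨hs⟩` labels a loop at the base vertex of `Δ`. The graph `E` carries the loops labeled by
`hs`, and in the graph `Γ` the accepted words for the elements of the cosets occurring as vertices
of `E` can be read. -/
def Saturated (d : AutData n) (hs : List (GWord n)) (Δ Γ E : FinGraph n) : Prop :=
  (∃ v, Represents d [] v ∧ Γ.run v = some []) ∧
  (∀ h ∈ hs, E.run h = some [] ∧ E.run (FreeGroup.invRev h) = some []) ∧
  (∀ e ∈ E, Tracks (d.multiplier (some e.1.2)) Γ e.1.1 Γ e.2) ∧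
  Tracks (d.multiplier none) Γ [] Γ [] ∧ Tracks (d.multiplier none) Γ [] Δ []

/-- The part of a certificate that shows that an edge `((p, x), q)` is one of the Stallings
graph: it is an edge of the Schreier graph, and it is traversed, in one direction or the other,
by an accepted word that represents an element of `⟨hs⟩`. -/
def EdgeCert (d : AutData n) (hs : List (GWord n)) (e : (GWord n × Letter n) × GWord n) : Prop :=
  InGenerated d hs (e.1.1 ++ [e.1.2] ++ FreeGroup.invRev e.2) ∧
  ∃ (u : GWord n) (y : Letter n) (v : GWord n),
    u ++ y :: v ∈ d.language ∧ InGenerated d hs (u ++ y :: v) ∧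
    ((y = e.1.2 ∧ InGenerated d hs (u ++ FreeGroup.invRev e.1.1)) ∨
      (y = invLetter e.1.2 ∧
        InGenerated d hs (u ++ FreeGroup.invRev (e.1.1 ++ [e.1.2]))))

/-- The base vertex and the origins of the edges. -/
abbrev FinGraph.origins (Δ : FinGraph n) : List (GWord n) := [] :: Δ.map fun e => e.1.1

/-- A condition, verifiable without knowledge of the group, under which `Δ` is the Stallings
graph of `⟨hs⟩`, each vertex being named by a word that represents an element of the coset.
That distinct vertices are distinct cosets is shown by accepted words that do not label loops. -/
def StallingsCert (d : AutData n) (hs : List (GWord n)) (Δ : FinGraph n) : Prop :=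
  (∃ Γ E, Saturated d hs Δ Γ E) ∧
  (∀ e ∈ Δ, EdgeCert d hs e ∧ ((e.2, invLetter e.1.2), e.1.1) ∈ Δ) ∧
  ∀ p ∈ Δ.origins, ∀ q ∈ Δ.origins,
    p = q ∨ ∃ w, Represents d (p ++ FreeGroup.invRev q) w ∧ Δ.run w ≠ some []

@[fun_prop]
theorem Primrec.finGraph_origins {β : Type} [Primcodable β] {Δ : β → FinGraph n}
    (hΔ : Primrec Δ) : Primrec fun b => (Δ b).origins :=
  .cons_comp (.const _) (list_map hΔ (g := fun _ e => e.1.1) (by unfold Primrec₂; fun_prop))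

theorem SemiDec.stallingsCert {β : Type} [Primcodable β] {d : β → AutData n}
    {hs : β → List (GWord n)} {Δ : β → FinGraph n} (hd : Primrec d) (hhs : Primrec hs)
    (hΔ : Primrec Δ) : SemiDec fun b => StallingsCert (d b) (hs b) (Δ b) := by
  refine .and (.ex (.ex (.and (.ex (.and (.represents ?_ ?_ ?_) (.eq ?_ ?_))) (.and
    (.forall_mem (.and (.eq ?_ ?_) (.eq ?_ ?_)) ?_) (.and
    (.forall_mem (.tracks ?_ ?_ ?_ ?_ ?_) ?_) (.and (.tracks ?_ ?_ ?_ ?_ ?_)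
      (.tracks ?_ ?_ ?_ ?_ ?_)))))))
    (.and (.forall_mem (.and (.and (.inGenerated ?_ ?_ ?_) (.ex (.ex (.ex
      (.and (.mem_autData_language ?_ ?_) (.and (.inGenerated ?_ ?_ ?_)
      (.or (.and (.eq ?_ ?_) (.inGenerated ?_ ?_ ?_))
        (.and (.eq ?_ ?_) (.inGenerated ?_ ?_ ?_)))))))))
      (.mem ?_ ?_)) ?_)
    (.forall_mem (.forall_mem (.or (.eq ?_ ?_)
      (.ex (.and (.represents ?_ ?_ ?_) (.ne ?_ ?_)))) ?_) ?_))
  all_goals fun_prop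

variable {G : Type*} [Group G] {γ : Fin n → G} {d : AutData n} {hs : List (GWord n)}
  {Δ Γ E : FinGraph n}

namespace FinGraph

theorem run_append_of_run_eq {Γ : FinGraph n} {u v : GWord n} (hu : Γ.run u = some []) :
    Γ.run (u ++ v) = Γ.run v := by
  rw [run, List.foldl_append, ← run, hu, run]

end FinGraph

namespace Saturated

/-- The accepted words for an element of `⟨hs⟩` are obtained from those for the identity by
multiplying with one letter after the other along a loop of `E`; in `Γ` their runs follow the
vertices of this loop. -/
theorem run_eq_of_mem (hd : IsAutomaticStructure γ d) (h : Saturated d hs Δ Γ E) {w : GWord n}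
    (hL : w ∈ d.language) (hH : evalWord γ w ∈ generatedBy γ hs) : Δ.run w = some [] := by
  obtain ⟨⟨v₀, hv₀, hrun⟩, hE, hstep, hnone, hΔ⟩ := h
  rw [hd.represents_iff] at hv₀
  rw [hd.tracks_iff] at hnone hΔ
  -- The accepted words for the element given by a path of `E` lead to the endpoint of the path.
  have key : ∀ z p, E.run z = some p → ∀ v ∈ d.language, evalWord γ v = evalWord γ z →
      Γ.run v = some p := by
    intro z
    induction z using List.reverseRecOn with
    | nil =>
      intro p hp v hv he
      obtain rfl : [] = p := Option.some.inj hp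
      exact hnone v₀ hv₀.1 v hv (by simp [hv₀.2, he]) hrun
    | append_singleton z x ih =>
      intro p hp v hv he
      rw [FinGraph.run_concat] at hp
      cases hz : E.run z with
      | none => simp [hz, FinGraph.step] at hp
      | some p' =>
        rw [hz] at hp
        obtain ⟨u, hu, hue⟩ := hd.1 (evalWord γ z)
        exact hd.tracks_iff.1 (hstep _ (FinGraph.mem_of_step_eq hp)) u hu v hv
          (by simp [hue, he]) (ih p' hz u hu hue)
  obtain ⟨zs, hzs, he⟩ := exists_flatten_of_mem_generatedBy γ hH
  have hrun : E.run zs.flatten = some [] := by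
    clear he
    induction zs with
    | nil => rfl
    | cons z zs ih =>
      rw [List.flatten_cons, FinGraph.run_append_of_run_eq]
      · exact ih fun y hy => hzs y (List.mem_cons_of_mem _ hy)
      · rcases hzs z List.mem_cons_self with hz | hz
        · exact (hE z hz).1
        · simpa using (hE _ hz).2
  exact hΔ w hL w hL (by simp) (key _ _ hrun w hL he.symm)

end Saturated

theorem EdgeCert.traversed_mem (hd : IsAutomaticStructure γ d) {p q : GWord n} {x : Letter n}
    (h : EdgeCert d hs ((p, x), q)) :
    wordCoset γ (generatedBy γ hs) q = wordCoset γ (generatedBy γ hs) (p ++ [x]) ∧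
    AGraph.traversed (wordCoset γ (generatedBy γ hs) p) x (wordCoset γ (generatedBy γ hs) q) ∈
      (stallingsGraph γ d.language (generatedBy γ hs)).edges := by
  simp only [EdgeCert, hd.inGenerated_iff, ← wordCoset_eq_iff] at h
  exact ⟨h.1.symm, traversed_mem_stallingsGraph.2 ⟨h.1.symm, h.2⟩⟩

theorem edgeCert_of_traversed_mem (hd : IsAutomaticStructure γ d) {p q : GWord n} {x : Letter n}
    (h : AGraph.traversed (wordCoset γ (generatedBy γ hs) p) x
      (wordCoset γ (generatedBy γ hs) q) ∈
      (stallingsGraph γ d.language (generatedBy γ hs)).edges) :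
    EdgeCert d hs ((p, x), q) := by
  rw [traversed_mem_stallingsGraph] at h
  simp only [EdgeCert, hd.inGenerated_iff, ← wordCoset_eq_iff]
  exact ⟨h.1.symm, h.2⟩

namespace StallingsCert

theorem eq_of_wordCoset_eq (hd : IsAutomaticStructure γ d) (h : StallingsCert d hs Δ)
    {p q : GWord n} (hp : p ∈ Δ.origins) (hq : q ∈ Δ.origins)
    (he : wordCoset γ (generatedBy γ hs) p = wordCoset γ (generatedBy γ hs) q) : p = q := by
  obtain ⟨⟨Γ, E, hsat⟩, -, hinj⟩ := h
  refine (hinj p hp q hq).resolve_right ?_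
  rintro ⟨w, hw, hne⟩
  rw [hd.represents_iff] at hw
  rw [wordCoset_eq_iff] at he
  exact hne (hsat.run_eq_of_mem hd hw.1 (hw.2 ▸ he))

theorem mem_origins_of_run_eq (h : StallingsCert d hs Δ) {w b : GWord n}
    (hb : Δ.run w = some b) : b ∈ Δ.origins := by
  have := FinGraph.run_mem_runStates (Γ := Δ) w
  rw [hb] at this
  simp only [FinGraph.runStates, List.mem_cons, reduceCtorEq, Option.some.injEq, false_or] at this
  rcases this with rfl | this
  · exact List.mem_cons_self
  · obtain ⟨e, he, hb⟩ := List.mem_map.1 this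
    obtain rfl := Option.some.inj hb
    exact List.mem_cons_of_mem _ (List.mem_map.2 ⟨_, (h.2.1 e he).2, rfl⟩)

theorem isPath_of_run_eq (hd : IsAutomaticStructure γ d) (h : StallingsCert d hs Δ)
    {w b : GWord n} (hb : Δ.run w = some b) :
    (stallingsGraph γ d.language (generatedBy γ hs)).IsPath
      (wordCoset γ (generatedBy γ hs) []) w (wordCoset γ (generatedBy γ hs) b) := by
  induction w using List.reverseRecOn generalizing b with
  | nil =>
    obtain rfl : [] = b := Option.some.inj hb
    exact rfl
  | append_singleton w x ih =>
    rw [FinGraph.run_concat] at hb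
    cases hw : Δ.run w with
    | none => simp [hw, FinGraph.step] at hb
    | some p =>
      rw [hw] at hb
      exact AGraph.isPath_append.2 ⟨_, ih hw, AGraph.isPath_singleton.2
        ((h.2.1 _ (FinGraph.mem_of_step_eq hb)).1.traversed_mem hd).2⟩

theorem wordCoset_eq_of_run_eq (hd : IsAutomaticStructure γ d) (h : StallingsCert d hs Δ)
    {w b : GWord n} (hb : Δ.run w = some b) :
    wordCoset γ (generatedBy γ hs) b = wordCoset γ (generatedBy γ hs) w :=
  eq_wordCoset_of_isPath_stallingsGraph (h.isPath_of_run_eq hd hb)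

/-- Every path of the Stallings graph can be read in a certified graph: each edge lies on a loop
labeled by an accepted word, which can be read in `Δ` as well, and it is read there at the right
vertex because vertices are determined by their cosets. -/
theorem exists_run_eq_of_isPath (hd : IsAutomaticStructure γ d) (h : StallingsCert d hs Δ)
    {w : GWord n} {c : RightCosets (generatedBy γ hs)}
    (hp : (stallingsGraph γ d.language (generatedBy γ hs)).IsPath
      (wordCoset γ (generatedBy γ hs) []) w c) : ∃ b, Δ.run w = some b := by
  induction w using List.reverseRecOn generalizing c with
  | nil => exact ⟨_, rfl⟩
  | append_singleton w x ih =>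
    obtain ⟨r, hr, hx⟩ := AGraph.isPath_append.1 hp
    rw [AGraph.isPath_singleton] at hx
    obtain ⟨b, hb⟩ := ih hr
    obtain rfl := eq_wordCoset_of_isPath_stallingsGraph hr
    obtain ⟨rfl, u, y, v, hL, hH, huy⟩ := traversed_mem_stallingsGraph.1 hx
    obtain ⟨Γ, E, hsat⟩ := h.1
    have hloop := hsat.run_eq_of_mem hd hL hH
    -- The run along the accepted word passes an edge labeled by `y` right after `u`.
    obtain ⟨p, q, hup, hpq⟩ : ∃ p q, Δ.run u = some p ∧ Δ.step (some p) y = some q := by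
      rw [← List.singleton_append, ← List.append_assoc, FinGraph.run, List.foldl_append,
        ← FinGraph.run, FinGraph.run_concat] at hloop
      have hnone : ∀ v : GWord n, v.foldl Δ.step none = none := by
        intro v
        induction v with
        | nil => rfl
        | cons x v ih => exact ih
      cases hu : Δ.run u with
      | none => rw [hu, show Δ.step none y = none from rfl, hnone] at hloop; cases hloop
      | some p =>
        cases hq : Δ.step (some p) y with
        | none => rw [hu, hq, hnone] at hloop; cases hloop
        | some q => exact ⟨p, q, rfl, hq⟩
    have hmem := FinGraph.mem_of_step_eq hpq
    have hcp := h.wordCoset_eq_of_run_eq hd hup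
    have hcb := h.wordCoset_eq_of_run_eq hd hb
    have hbo := h.mem_origins_of_run_eq hb
    rw [FinGraph.run_concat, hb]
    rcases huy with ⟨rfl, hu⟩ | ⟨rfl, hu⟩
    · obtain rfl : p = b := h.eq_of_wordCoset_eq hd (h.mem_origins_of_run_eq hup) hbo
        (by rw [hcp, hcb, hu])
      exact ⟨q, hpq⟩
    · have hback := (h.2.1 _ hmem).2
      simp only [invLetter, Bool.not_not] at hback
      have hcq := h.wordCoset_eq_of_run_eq hd (w := u ++ [invLetter x]) (b := q)
        (by rw [FinGraph.run_concat, hup, hpq])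
      obtain rfl : q = b := h.eq_of_wordCoset_eq hd
        (List.mem_cons_of_mem _ (List.mem_map.2 ⟨_, hback, rfl⟩)) hbo
        (by rw [hcq, hcb, wordCoset_append_congr hu, wordCoset_append_invLetter])
      exact FinGraph.exists_step_eq hback

/-- A certified graph has the same loops as the Stallings graph. -/
theorem run_eq_base_iff (hd : IsAutomaticStructure γ d) (h : StallingsCert d hs Δ)
    {w : GWord n} : Δ.run w = some [] ↔
      (stallingsGraph γ d.language (generatedBy γ hs)).IsPath
        (wordCoset γ (generatedBy γ hs) []) w (wordCoset γ (generatedBy γ hs) []) := by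
  refine ⟨h.isPath_of_run_eq hd, fun hp => ?_⟩
  obtain ⟨b, hb⟩ := h.exists_run_eq_of_isPath hd hp
  obtain rfl : b = [] := h.eq_of_wordCoset_eq hd (h.mem_origins_of_run_eq hb) List.mem_cons_self
    ((h.wordCoset_eq_of_run_eq hd hb).trans (eq_wordCoset_of_isPath_stallingsGraph hp).symm)
  exact hb

end StallingsCert

end Certificate

/-! ### Existence of certificates -/

section Named

variable {n : ℕ} {G : Type*} [Group G] (γ : Fin n → G) {H : Subgroup G}

/-- The finite graph `Γ` consists of the edges of the Schreier graph that leave a coset `c` with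
a letter `x` for `(c, x)` in `S`, the cosets being named by words. -/
def IsNamedGraph (name : RightCosets H → GWord n) (S : Set (RightCosets H × Letter n))
    (Γ : FinGraph n) : Prop :=
  ∀ p x q, ((p, x), q) ∈ Γ ↔
    ∃ c, (c, x) ∈ S ∧ p = name c ∧ q = name (wordCoset γ H (p ++ [x]))

/-- The cosets that are reached from `H` by words of length at most `l`. -/
def cosetBall (H : Subgroup G) (l : ℕ) : Set (RightCosets H) :=
  wordCoset γ H '' {v | v.length ≤ l}

theorem finite_cosetBall (l : ℕ) : (cosetBall γ H l).Finite :=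
  (List.finite_length_le _ l).image _

variable {γ} {name : RightCosets H → GWord n} {S : Set (RightCosets H × Letter n)}

theorem exists_isNamedGraph (hS : S.Finite) : ∃ Γ, IsNamedGraph γ name S Γ := by
  refine ⟨hS.toFinset.toList.map fun e =>
    ((name e.1, e.2), name (wordCoset γ H (name e.1 ++ [e.2]))), fun p x q => ?_⟩
  simp only [List.mem_map, Finset.mem_toList, Set.Finite.mem_toFinset]
  constructor
  · rintro ⟨⟨c, _⟩, hc, h⟩
    obtain ⟨⟨rfl, rfl⟩, rfl⟩ := by simpa only [Prod.mk.injEq] using h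
    exact ⟨c, hc, rfl, rfl⟩
  · rintro ⟨c, hc, rfl, rfl⟩
    exact ⟨(c, x), hc, rfl⟩

namespace IsNamedGraph

variable {Γ : FinGraph n}

theorem run_eq (h : IsNamedGraph γ name S Γ) (hwc : ∀ c, wordCoset γ H (name c) = c)
    (hbase : name (wordCoset γ H []) = []) {w p : GWord n} (hp : Γ.run w = some p) :
    p = name (wordCoset γ H w) := by
  induction w using List.reverseRecOn generalizing p with
  | nil => rw [hbase]; exact (Option.some.inj hp).symm
  | append_singleton w x ih =>
    rw [FinGraph.run_concat] at hp
    cases hw : Γ.run w with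
    | none => simp [hw, FinGraph.step] at hp
    | some q =>
      rw [hw] at hp
      obtain ⟨-, -, -, rfl⟩ := (h _ _ _).1 (FinGraph.mem_of_step_eq hp)
      rw [wordCoset_append_congr (w' := w) (by rw [ih hw, hwc])]

theorem run_eq_of_prefixes (h : IsNamedGraph γ name S Γ)
    (hwc : ∀ c, wordCoset γ H (name c) = c) (hbase : name (wordCoset γ H []) = [])
    {w : GWord n} (hS : ∀ u x, u ++ [x] <+: w → (wordCoset γ H u, x) ∈ S) :
    Γ.run w = some (name (wordCoset γ H w)) := by
  induction w using List.reverseRecOn with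
  | nil => rw [hbase]; rfl
  | append_singleton w x ih =>
    obtain ⟨p, hp⟩ := FinGraph.exists_step_eq ((h _ _ _).2
      ⟨_, hS w x List.prefix_rfl, rfl, rfl⟩)
    rw [← ih fun u y hu => hS u y (hu.trans (List.prefix_append _ _)),
      ← FinGraph.run_concat] at hp
    rw [hp, h.run_eq hwc hbase hp]

end IsNamedGraph

end Named

section Existence

variable {n : ℕ} {G : Type*} [Group G] {γ : Fin n → G} {d : AutData n}

/-- The accepted words that represent elements of finitely many cosets of a quasi-convex subgroup
pass only finitely many cosets, by the fellow traveller property. -/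
theorem IsAutomaticStructure.exists_cosetBall {H : Subgroup G} (hd : IsAutomaticStructure γ d)
    (hH : IsQuasiConvex γ d.language (H : Set G)) (l : ℕ) :
    ∃ K, ∀ w ∈ d.language, wordCoset γ H w ∈ cosetBall γ H l → ∀ p, p <+: w →
      wordCoset γ H p ∈ cosetBall γ H K := by
  have hmono : ∀ {i j : ℕ}, i ≤ j → cosetBall γ H i ⊆ cosetBall γ H j := fun hij =>
    Set.image_mono fun v (hv : v.length ≤ _) => hv.trans hij
  induction l with
  | zero =>
    obtain ⟨k, hk⟩ := hH
    refine ⟨k, fun w hw hwc p hp => ?_⟩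
    obtain ⟨v, hv, he⟩ := hwc
    obtain rfl : v = [] := List.length_eq_zero_iff.1 (Nat.le_zero.1 hv)
    obtain ⟨s, hs, v, hv, he⟩ := hk w hw (wordCoset_eq_base_iff.1 he.symm) p hp
    refine ⟨FreeGroup.invRev v, by simpa using hv, ?_⟩
    rw [eq_comm, wordCoset_eq_iff]
    simpa [he] using hs
  | succ l ih =>
    obtain ⟨K, hK⟩ := ih
    choose N hN using fun x : Letter n => hd.exists_fellow_travel (some x)
    let M := Finset.univ.sup N
    refine ⟨K + M, fun w hw hwc p hp => ?_⟩
    obtain ⟨v, hv, he⟩ := hwc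
    obtain rfl | ⟨v, x, rfl⟩ := List.eq_nil_or_concat' v
    · exact hmono (by omega) (hK w hw ⟨[], by simp, he⟩ p hp)
    · -- An accepted word `u` for the element `w x⁻¹`, which lies in the coset of `v`.
      obtain ⟨u, hu, hue⟩ := hd.1 (evalWord γ (w ++ [invLetter x]))
      have huv : wordCoset γ H u = wordCoset γ H v := by
        rw [wordCoset, hue, ← wordCoset, ← wordCoset_append_congr he,
          wordCoset_append_invLetter]
      obtain ⟨p', hp', z, hz, hpz⟩ := hN x u hu w hw
        (by simp [hue, evalWord_invLetter]) p hp
      obtain ⟨t, ht, hte⟩ := hK u hu ⟨v, by simpa using hv, huv.symm⟩ p' hp'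
      have hzM : z.length ≤ M := hz.trans (Finset.le_sup (Finset.mem_univ x))
      have ht : t.length ≤ K := ht
      refine ⟨t ++ z, ?_, ?_⟩
      · simp only [Set.mem_ofPred_eq, List.length_append]
        omega
      · rw [wordCoset_append_congr hte, wordCoset, wordCoset, hpz, evalWord_append]

/-- The Stallings graph itself is certified. The cosets are named by words, `Δ` consists of the
edges of the Stallings graph, `E` of those inside a ball that contains the loops labeled by `hs`,
and `Γ` of those leaving a larger ball that contains all accepted words ending in the first. -/
theorem exists_stallingsCert (hd : IsAutomaticStructure γ d) {hs : List (GWord n)}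
    (hH : IsQuasiConvex γ d.language (generatedBy γ hs : Set G)) :
    ∃ Δ, StallingsCert d hs Δ := by
  set H := generatedBy γ hs with hHdef
  have hex : ∀ c : RightCosets H, ∃ w, wordCoset γ H w = c ∧ (c = wordCoset γ H [] → w = []) := by
    intro c
    by_cases hc : c = wordCoset γ H []
    · exact ⟨[], hc.symm, fun _ => rfl⟩
    · obtain ⟨g, rfl⟩ := Quotient.exists_rep c
      obtain ⟨w, -, rfl⟩ := hd.1 g
      exact ⟨w, rfl, fun h => (hc h).elim⟩
  choose name hwc hbase using hex
  have hbase : name (wordCoset γ H []) = [] := hbase _ rfl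
  have hname : ∀ {c c'}, name c = name c' → c = c' := fun {c c'} h => by
    rw [← hwc c, h, hwc]
  let l := hs.toFinset.sup List.length
  obtain ⟨K, hK⟩ := hd.exists_cosetBall hH l
  have hnil : ∀ i, wordCoset γ H [] ∈ cosetBall γ H i := fun i => ⟨[], by simp, rfl⟩
  obtain ⟨Γ, hΓ⟩ := exists_isNamedGraph (γ := γ) (name := name)
    ((finite_cosetBall γ (H := H) K).prod Set.finite_univ)
  obtain ⟨E, hE⟩ := exists_isNamedGraph (γ := γ) (name := name)
    (S := {e | e.1 ∈ cosetBall γ H l ∧ wordCoset γ H (name e.1 ++ [e.2]) ∈ cosetBall γ H l})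
    (((finite_cosetBall γ (H := H) l).prod Set.finite_univ).subset fun e he => ⟨he.1, trivial⟩)
  -- `Γ` can read all accepted words that end in the ball of radius `l`.
  have hΓrun : ∀ w ∈ d.language, wordCoset γ H w ∈ cosetBall γ H l →
      Γ.run w = some (name (wordCoset γ H w)) := fun w hw hwl =>
    hΓ.run_eq_of_prefixes hwc hbase fun u x hu =>
      ⟨hK w hw hwl u ((List.prefix_append _ _).trans hu), trivial⟩
  have hErun : ∀ w : GWord n, w.length ≤ l → E.run w = some (name (wordCoset γ H w)) :=
    fun w hw => hE.run_eq_of_prefixes hwc hbase fun u x hu => by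
      have hlen := hu.length_le
      simp only [List.length_append, List.length_singleton] at hlen
      refine ⟨⟨u, show u.length ≤ l by omega, rfl⟩, ?_⟩
      rw [wordCoset_append_congr (w' := u) (hwc _)]
      exact ⟨u ++ [x], by simpa using by omega, rfl⟩
  have hsat : ∀ u ∈ d.language, evalWord γ u ∈ H → ∀ y z, u = y ++ z →
      wordCoset γ H y ∈ cosetBall γ H K := fun u hu huH y z hyz =>
    hK u hu (by rw [wordCoset_eq_base_iff.2 huH]; exact hnil l) y ⟨z, hyz.symm⟩
  obtain ⟨Δ, hΔ⟩ := exists_isNamedGraph (γ := γ) (name := name)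
    (S := {e | AGraph.traversed e.1 e.2 (wordCoset γ H (name e.1 ++ [e.2])) ∈
      (stallingsGraph γ d.language H).edges})
    (((finite_cosetBall γ (H := H) K).prod Set.finite_univ).subset fun e he => by
      obtain ⟨c, x⟩ := e
      rw [Set.mem_ofPred_eq, ← hwc c, traversed_mem_stallingsGraph, hwc] at he
      obtain ⟨-, u, y, v, hL, hH', ⟨rfl, hu⟩ | ⟨rfl, hu⟩⟩ := he
      · exact ⟨hu ▸ hsat _ hL hH' u _ rfl, trivial⟩
      · have := hsat _ hL hH' (u ++ [invLetter x]) v (by simp)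
        rw [wordCoset_append_congr hu, wordCoset_append_invLetter, hwc] at this
        exact ⟨this, trivial⟩)
  have hΔrun : ∀ w ∈ d.language, evalWord γ w ∈ H → Δ.run w = some [] := by
    intro w hw hwH
    rw [hΔ.run_eq_of_prefixes hwc hbase, wordCoset_eq_base_iff.2 hwH, hbase]
    rintro u x ⟨v, rfl⟩
    rw [List.append_assoc] at hw hwH
    refine traversed_mem_stallingsGraph.2 ⟨wordCoset_append_congr (hwc _) _,
      u, x, v, hw, hwH, .inl ⟨rfl, rfl⟩⟩
  have hΓH : ∀ w, Γ.run w = some [] → evalWord γ w ∈ H := fun w hw => by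
    rw [← wordCoset_eq_base_iff]
    exact hname ((hΓ.run_eq hwc hbase hw).symm.trans hbase.symm)
  have hedge : ∀ e ∈ Δ, ∃ c, e.1.1 = name c ∧ e.2 = name (wordCoset γ H (e.1.1 ++ [e.1.2])) ∧
      AGraph.traversed (wordCoset γ H e.1.1) e.1.2 (wordCoset γ H e.2) ∈
        (stallingsGraph γ d.language H).edges := by
    rintro ⟨⟨p, x⟩, q⟩ he
    obtain ⟨c, hc, rfl, rfl⟩ := (hΔ _ _ _).1 he
    exact ⟨c, rfl, rfl, by simpa only [hwc, Set.mem_ofPred_eq] using hc⟩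
  refine ⟨Δ, ⟨Γ, E, ?_, ?_, ?_, ?_, ?_⟩, fun e he => ⟨?_, ?_⟩, fun p hp q hq => ?_⟩
  · obtain ⟨v, hv, hve⟩ := hd.1 1
    have hv' : wordCoset γ H v = wordCoset γ H [] := by
      rw [wordCoset_eq_base_iff, hve]
      exact one_mem _
    refine ⟨v, hd.represents_iff.2 ⟨hv, by simp [hve]⟩, ?_⟩
    rw [hΓrun v hv (hv' ▸ hnil l), hv', hbase]
  · intro h hh
    have hl : h.length ≤ l := Finset.le_sup (f := List.length) (List.mem_toFinset.2 hh)
    have hhH : evalWord γ h ∈ H := evalWord_mem_generatedBy γ hh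
    have hhH' : evalWord γ (FreeGroup.invRev h) ∈ H := by simpa using hhH
    rw [hErun h hl, hErun _ (by simpa using hl), wordCoset_eq_base_iff.2 hhH,
      wordCoset_eq_base_iff.2 hhH', hbase]
    exact ⟨rfl, rfl⟩
  · rintro ⟨⟨p, x⟩, q⟩ he
    obtain ⟨c, ⟨-, hc⟩, rfl, rfl⟩ := (hE _ _ _).1 he
    refine hd.tracks_iff.2 fun u hu v hv hue hrun => ?_
    have huc : wordCoset γ H u = c := (hname (hΓ.run_eq hwc hbase hrun)).symm
    have hvc : wordCoset γ H v = wordCoset γ H (name c ++ [x]) := by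
      rw [wordCoset_append_congr ((hwc c).trans huc.symm), wordCoset, ← hue]
      rfl
    rw [hΓrun v hv (hvc ▸ hc), hvc]
  · refine hd.tracks_iff.2 fun u hu v hv hue hrun => ?_
    have hvH : evalWord γ v ∈ H := by simpa [← hue] using hΓH u hrun
    rw [hΓrun v hv (by rw [wordCoset_eq_base_iff.2 hvH]; exact hnil l),
      wordCoset_eq_base_iff.2 hvH, hbase]
  · refine hd.tracks_iff.2 fun u hu v hv hue hrun => hΔrun v hv ?_
    simpa [← hue] using hΓH u hrun
  · exact edgeCert_of_traversed_mem hd (hedge e he).choose_spec.2.2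
  · obtain ⟨c, h₁, h₂, h₃⟩ := hedge e he
    have hback : wordCoset γ H (e.2 ++ [invLetter e.1.2]) = wordCoset γ H e.1.1 := by
      rw [h₂, wordCoset_append_congr (hwc _), wordCoset_append_invLetter]
    refine (hΔ _ _ _).2 ⟨wordCoset γ H e.2, ?_, ?_, ?_⟩
    · rw [Set.mem_ofPred_eq, wordCoset_append_congr (hwc _), hback, AGraph.traversed_not]
      exact h₃
    · rw [h₂, hwc]
    · rw [hback, h₁, hwc]
  · have hor : ∀ p ∈ Δ.origins, ∃ c, p = name c := by
      intro p hp
      rcases List.mem_cons.1 hp with rfl | hp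
      · exact ⟨_, hbase.symm⟩
      · obtain ⟨e, he, rfl⟩ := List.mem_map.1 hp
        exact ⟨_, (hedge e he).choose_spec.1⟩
    obtain ⟨c, rfl⟩ := hor p hp
    obtain ⟨c', rfl⟩ := hor q hq
    refine or_iff_not_imp_left.2 fun hne => ?_
    obtain ⟨w, hw, hwe⟩ := hd.1 (evalWord γ (name c ++ FreeGroup.invRev (name c')))
    refine ⟨w, hd.represents_iff.2 ⟨hw, hwe⟩, fun hrun => hne ?_⟩
    have hwH : evalWord γ w ∈ H := wordCoset_eq_base_iff.1
      (hname ((hΔ.run_eq hwc hbase hrun).symm.trans hbase.symm))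
    rw [hwe, ← wordCoset_eq_iff, hwc, hwc] at hwH
    rw [hwH]

end Existence

/-! ### Generators of the group of loops of a product graph -/

section Spanning

variable {n : ℕ}

/-- The list `τ` assigns a word to each vertex of the component of the base vertex in the product
of two graphs, as a spanning tree does, and `out` consists of labels of loops and contains, for
each edge, the label of the loop that passes this edge and otherwise follows the words of `τ`. -/
def SpanningCert (Δ₁ Δ₂ : FinGraph n) (τ : List ((GWord n × GWord n) × GWord n))
    (out : List (GWord n)) : Prop :=
  (∀ w ∈ out, Δ₁.run w = some [] ∧ Δ₂.run w = some []) ∧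
  (([], []), []) ∈ τ ∧ (∀ s ∈ τ, s.1 = ([], []) → s.2 = []) ∧
  ∀ s ∈ τ, ∀ x ∈ (Finset.univ : Finset (Letter n)).toList,
    Δ₁.step (some s.1.1) x = none ∨ Δ₂.step (some s.1.2) x = none ∨
      ∃ t ∈ τ, Δ₁.step (some s.1.1) x = some t.1.1 ∧ Δ₂.step (some s.1.2) x = some t.1.2 ∧
        s.2 ++ x :: FreeGroup.invRev t.2 ∈ out

theorem SemiDec.spanningCert {β : Type} [Primcodable β] {Δ₁ Δ₂ : β → FinGraph n}
    {τ : β → List ((GWord n × GWord n) × GWord n)} {out : β → List (GWord n)}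
    (h₁ : Primrec Δ₁) (h₂ : Primrec Δ₂) (hτ : Primrec τ) (hout : Primrec out) :
    SemiDec fun b => SpanningCert (Δ₁ b) (Δ₂ b) (τ b) (out b) := by
  refine .and (.forall_mem (.and (.eq ?_ ?_) (.eq ?_ ?_)) ?_) (.and (.mem ?_ ?_)
    (.and (.forall_mem (.eq_imp ?_ ?_ (.eq ?_ ?_)) ?_)
    (.forall_mem (.forall_mem (.or (.eq ?_ ?_) (.or (.eq ?_ ?_)
      (.exists_mem (.and (.eq ?_ ?_) (.and (.eq ?_ ?_) (.mem ?_ ?_))) ?_))) ?_) ?_)))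
  all_goals fun_prop

variable {Δ₁ Δ₂ : FinGraph n}

theorem SpanningCert.mk_mem_closure {τ : List ((GWord n × GWord n) × GWord n)}
    {out : List (GWord n)} (h : SpanningCert Δ₁ Δ₂ τ out) {w : GWord n}
    (h₁ : Δ₁.run w = some []) (h₂ : Δ₂.run w = some []) :
    FreeGroup.mk w ∈
      Subgroup.closure {x : FreeGroup (Fin n) | ∃ w ∈ out, FreeGroup.mk w = x} := by
  obtain ⟨-, hbase, huniq, hstep⟩ := h
  -- A path differs from the word of its endpoint by a product of elements of `out`.
  have key : ∀ (w : GWord n) b₁ b₂, Δ₁.run w = some b₁ → Δ₂.run w = some b₂ →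
      ∃ t, ((b₁, b₂), t) ∈ τ ∧ FreeGroup.mk w * (FreeGroup.mk t)⁻¹ ∈
        Subgroup.closure {x : FreeGroup (Fin n) | ∃ w ∈ out, FreeGroup.mk w = x} := by
    intro w
    induction w using List.reverseRecOn with
    | nil =>
      intro b₁ b₂ h₁ h₂
      obtain rfl := Option.some.inj h₁
      obtain rfl := Option.some.inj h₂
      exact ⟨[], hbase, by simp [← FreeGroup.one_eq_mk, one_mem]⟩
    | append_singleton w x ih =>
      intro b₁ b₂ h₁ h₂
      rw [FinGraph.run_concat] at h₁ h₂
      cases hw₁ : Δ₁.run w with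
      | none => simp [hw₁, FinGraph.step] at h₁
      | some c₁ =>
        cases hw₂ : Δ₂.run w with
        | none => simp [hw₂, FinGraph.step] at h₂
        | some c₂ =>
          rw [hw₁] at h₁
          rw [hw₂] at h₂
          obtain ⟨s, hs, hmem⟩ := ih c₁ c₂ hw₁ hw₂
          rcases hstep _ hs x (by simp) with h | h | ⟨⟨⟨c, c'⟩, t⟩, ht, ht₁, ht₂, hout⟩
          · rw [h] at h₁; cases h₁
          · rw [h] at h₂; cases h₂
          · obtain rfl := Option.some.inj (h₁.symm.trans ht₁)
            obtain rfl := Option.some.inj (h₂.symm.trans ht₂)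
            refine ⟨t, ht, ?_⟩
            have := mul_mem hmem (Subgroup.subset_closure ⟨_, hout, rfl⟩)
            convert this using 1
            rw [← List.singleton_append (l := FreeGroup.invRev t), ← FreeGroup.mul_mk,
              ← FreeGroup.mul_mk, ← FreeGroup.mul_mk, ← FreeGroup.inv_mk]
            group
  obtain ⟨t, ht, hmem⟩ := key w [] [] h₁ h₂
  obtain rfl := huniq _ ht rfl
  simpa [← FreeGroup.one_eq_mk] using hmem

/-- The list `out` consists of the loops given by all edges, the words of `τ` being arbitrary
labels of paths to the vertices. -/
theorem exists_spanningCert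
    (h₁ : ∀ u v b, Δ₁.run u = some b → Δ₁.run v = some b →
      Δ₁.run (u ++ FreeGroup.invRev v) = some [])
    (h₂ : ∀ u v b, Δ₂.run u = some b → Δ₂.run v = some b →
      Δ₂.run (u ++ FreeGroup.invRev v) = some []) :
    ∃ τ out, SpanningCert Δ₁ Δ₂ τ out := by
  let B : Set (GWord n × GWord n) := {b | ∃ w, Δ₁.run w = some b.1 ∧ Δ₂.run w = some b.2}
  have hB : B.Finite := by
    refine (((List.finite_toSet Δ₁.runStates).preimage (Option.some_injective _).injOn).prod
      ((List.finite_toSet Δ₂.runStates).preimage (Option.some_injective _).injOn)).subset ?_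
    rintro b ⟨w, hb₁, hb₂⟩
    exact ⟨show some b.1 ∈ Δ₁.runStates from hb₁ ▸ FinGraph.run_mem_runStates w,
      show some b.2 ∈ Δ₂.runStates from hb₂ ▸ FinGraph.run_mem_runStates w⟩
  have hex : ∀ b, ∃ w, b ∈ B → (Δ₁.run w = some b.1 ∧ Δ₂.run w = some b.2) ∧
      (b = ([], []) → w = []) := by
    intro b
    by_cases hb : b = ([], [])
    · exact ⟨[], fun _ => ⟨by simp [hb], fun _ => rfl⟩⟩
    · by_cases hbB : b ∈ B
      · obtain ⟨w, hw⟩ := hbB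
        exact ⟨w, fun _ => ⟨hw, fun h => (hb h).elim⟩⟩
      · exact ⟨[], fun h => (hbB h).elim⟩
  choose t ht using hex
  have hfin : {w | ∃ b ∈ B, ∃ x, ∃ c ∈ B, (Δ₁.step (some b.1) x = some c.1 ∧
      Δ₂.step (some b.2) x = some c.2) ∧ w = t b ++ x :: FreeGroup.invRev (t c)}.Finite := by
    refine ((hB.prod (Set.finite_univ.prod hB)).image fun e =>
      t e.1 ++ e.2.1 :: FreeGroup.invRev (t e.2.2)).subset ?_
    rintro _ ⟨b, hb, x, c, hc, -, rfl⟩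
    exact ⟨(b, x, c), ⟨hb, trivial, hc⟩, rfl⟩
  have hτ : ∀ s, s ∈ (hB.toFinset.toList.map fun b => (b, t b)) ↔ s.1 ∈ B ∧ s.2 = t s.1 := by
    rintro ⟨b, w⟩
    simp only [List.mem_map, Finset.mem_toList, Set.Finite.mem_toFinset, Prod.mk.injEq]
    constructor
    · rintro ⟨_, hb, rfl, rfl⟩
      exact ⟨hb, rfl⟩
    · rintro ⟨hb, rfl⟩
      exact ⟨b, hb, rfl, rfl⟩
  have hbase : (([], []) : GWord n × GWord n) ∈ B := ⟨[], rfl, rfl⟩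
  refine ⟨hB.toFinset.toList.map fun b => (b, t b), hfin.toFinset.toList, ?_, ?_, ?_, ?_⟩
  · intro w hw
    rw [Finset.mem_toList, Set.Finite.mem_toFinset] at hw
    obtain ⟨b, hb, x, c, hc, ⟨hx₁, hx₂⟩, rfl⟩ := hw
    rw [← List.singleton_append, ← List.append_assoc]
    exact ⟨h₁ _ _ _ (by rw [FinGraph.run_concat, (ht b hb).1.1, hx₁]) (ht c hc).1.1,
      h₂ _ _ _ (by rw [FinGraph.run_concat, (ht b hb).1.2, hx₂]) (ht c hc).1.2⟩
  · exact (hτ _).2 ⟨hbase, ((ht _ hbase).2 rfl).symm⟩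
  · intro s hs hs'
    obtain ⟨hsB, hs⟩ := (hτ s).1 hs
    rw [hs, (ht _ hsB).2 hs']
  · rintro ⟨b, w⟩ hs x -
    obtain ⟨hb, hw⟩ := (hτ _).1 hs
    simp only at hb hw ⊢
    subst hw
    cases hx₁ : Δ₁.step (some b.1) x with
    | none => exact .inl rfl
    | some c₁ =>
      cases hx₂ : Δ₂.step (some b.2) x with
      | none => exact .inr (.inl rfl)
      | some c₂ =>
        have hc : (c₁, c₂) ∈ B := ⟨t b ++ [x],
          by rw [FinGraph.run_concat, (ht b hb).1.1, hx₁],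
          by rw [FinGraph.run_concat, (ht b hb).1.2, hx₂]⟩
        refine .inr (.inr ⟨((c₁, c₂), t (c₁, c₂)), (hτ _).2 ⟨hc, rfl⟩, rfl, rfl, ?_⟩)
        rw [Finset.mem_toList, Set.Finite.mem_toFinset]
        exact ⟨b, hb, x, _, hc, ⟨hx₁, hx₂⟩, rfl⟩

end Spanning

/-- The relation between input and output that the algorithm realizes. -/
def IntersectionCert {n : ℕ} (d : AutData n) (hs ks out : List (GWord n)) : Prop :=
  ∃ Δ₁ Δ₂ τ, StallingsCert d hs Δ₁ ∧ StallingsCert d ks Δ₂ ∧ SpanningCert Δ₁ Δ₂ τ out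

theorem SemiDec.intersectionCert {n : ℕ} {β : Type} [Primcodable β] {d : β → AutData n}
    {hs ks out : β → List (GWord n)} (hd : Primrec d) (hhs : Primrec hs) (hks : Primrec ks)
    (hout : Primrec out) :
    SemiDec fun b => IntersectionCert (d b) (hs b) (ks b) (out b) := by
  refine .ex (.ex (.ex (.and (.stallingsCert ?_ ?_ ?_) (.and (.stallingsCert ?_ ?_ ?_)
    (.spanningCert ?_ ?_ ?_ ?_)))))
  all_goals fun_prop

/-! ### Intersections of quasi-convex subgroups -/

section Intersection

variable {n : ℕ} {G : Type*} [Group G] {γ : Fin n → G} {d : AutData n}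

theorem StallingsCert.run_append_invRev (hd : IsAutomaticStructure γ d) {hs : List (GWord n)}
    {Δ : FinGraph n} (h : StallingsCert d hs Δ) {u v b : GWord n} (hu : Δ.run u = some b)
    (hv : Δ.run v = some b) : Δ.run (u ++ FreeGroup.invRev v) = some [] :=
  (h.run_eq_base_iff hd).2 <|
    AGraph.isPath_append.2 ⟨_, h.isPath_of_run_eq hd hu, (h.isPath_of_run_eq hd hv).invRev⟩

theorem isPath_stallingsProduct {L : Language (Letter n)} {H K : Subgroup G} {w : GWord n}
    {q : RightCosets H × RightCosets K} :
    (stallingsProduct γ L H K).IsPath (rightCoset H 1, rightCoset K 1) w q ↔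
      (stallingsGraph γ L H).IsPath (wordCoset γ H []) w q.1 ∧
        (stallingsGraph γ L K).IsPath (wordCoset γ K []) w q.2 := by
  rw [stallingsProduct, AGraph.isPath_component, wordCoset_nil, wordCoset_nil]
  exact AGraph.isPath_prod

/-- Generators of the group of loops of the product of the Stallings graphs represent generators
of the intersection, since an accepted word for an element of the intersection labels a loop in
both Stallings graphs. -/
theorem generatedBy_eq_inf (hL : ∀ g : G, ∃ w ∈ d.language, evalWord γ w = g) {H K : Subgroup G}
    {out : List (GWord n)}
    (hout : (Subgroup.closure {x : FreeGroup (Fin n) | ∃ w ∈ out, FreeGroup.mk w = x} :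
        Set (FreeGroup (Fin n))) =
      (stallingsProduct γ d.language H K).loopSet (rightCoset H 1, rightCoset K 1)) :
    generatedBy γ out = H ⊓ K := by
  have hfold : ∀ J : Subgroup G, (stallingsGraph γ d.language J).Folded := fun J =>
    folded_stallingsGraph fun g => (hL g).imp fun _ h => h.2
  have hgen : (Subgroup.closure {x : FreeGroup (Fin n) | ∃ w ∈ out, FreeGroup.mk w = x}).map
      (FreeGroup.lift γ) = generatedBy γ out := by
    rw [MonoidHom.map_closure, generatedBy]
    congr 1
    ext g
    constructor
    · rintro ⟨_, ⟨w, hw, rfl⟩, rfl⟩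
      exact ⟨w, hw, rfl⟩
    · rintro ⟨w, hw, rfl⟩
      exact ⟨_, ⟨w, hw, rfl⟩, rfl⟩
  rw [← hgen]
  ext g
  constructor
  · rintro ⟨x, hx, rfl⟩
    rw [hout] at hx
    obtain ⟨h₁, h₂⟩ := isPath_stallingsProduct.1 hx
    have he : evalWord γ x.toWord = FreeGroup.lift γ x := by rw [evalWord, FreeGroup.mk_toWord]
    rw [← he]
    exact ⟨wordCoset_eq_base_iff.1 (wordCoset_nil.trans
        (eq_wordCoset_of_isPath_stallingsGraph h₁)).symm,
      wordCoset_eq_base_iff.1 (wordCoset_nil.trans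
        (eq_wordCoset_of_isPath_stallingsGraph h₂)).symm⟩
  · rintro ⟨hH, hK⟩
    obtain ⟨w, hw, rfl⟩ := hL g
    refine ⟨FreeGroup.mk w, ?_, rfl⟩
    rw [hout, AGraph.loopSet, Set.mem_ofPred_eq, isPath_stallingsProduct, FreeGroup.toWord_mk,
      ← wordCoset_nil (γ := γ), ← wordCoset_nil (γ := γ)]
    have hloop : ∀ J : Subgroup G, evalWord γ w ∈ J → (stallingsGraph γ d.language J).IsPath
        (wordCoset γ J []) (FreeGroup.reduce w) (wordCoset γ J []) := fun J hJ => by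
      have := isPath_stallingsGraph_of_prefix hw hJ List.prefix_rfl
      rw [wordCoset_eq_base_iff.2 hJ] at this
      exact (hfold J).isPath_of_red FreeGroup.reduce.red this
    exact ⟨hloop H hH, hloop K hK⟩

/-- For certified graphs, the certified words generate the group of loops of the component. -/
theorem SpanningCert.closure_eq_loopSet (hd : IsAutomaticStructure γ d) {hs ks : List (GWord n)}
    {Δ₁ Δ₂ : FinGraph n} (h₁ : StallingsCert d hs Δ₁) (h₂ : StallingsCert d ks Δ₂)
    {τ : List ((GWord n × GWord n) × GWord n)} {out : List (GWord n)}
    (h : SpanningCert Δ₁ Δ₂ τ out) :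
    (Subgroup.closure {x : FreeGroup (Fin n) | ∃ w ∈ out, FreeGroup.mk w = x} :
        Set (FreeGroup (Fin n))) =
      (stallingsProduct γ d.language (generatedBy γ hs) (generatedBy γ ks)).loopSet
        (rightCoset (generatedBy γ hs) 1, rightCoset (generatedBy γ ks) 1) := by
  have hfold : ∀ J : Subgroup G, (stallingsGraph γ d.language J).Folded := fun J =>
    folded_stallingsGraph fun g => (hd.1 g).imp fun _ h => h.2
  have hrun : ∀ w, (stallingsProduct γ d.language (generatedBy γ hs) (generatedBy γ ks)).IsPath
      (rightCoset (generatedBy γ hs) 1, rightCoset (generatedBy γ ks) 1) w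
      (rightCoset (generatedBy γ hs) 1, rightCoset (generatedBy γ ks) 1) ↔
      Δ₁.run w = some [] ∧ Δ₂.run w = some [] := fun w => by
    rw [isPath_stallingsProduct, h₁.run_eq_base_iff hd, h₂.run_eq_base_iff hd]
    simp only [wordCoset_nil]
  refine subset_antisymm ?_ fun x hx => ?_
  · have hprod : (stallingsProduct γ d.language (generatedBy γ hs)
        (generatedBy γ ks)).Folded :=
      ((hfold _).prod (hfold _)).mono fun e he => he.1
    exact hprod.closure_subset_loopSet fun w hw => (hrun w).2 (h.1 w hw)
  · obtain ⟨hx₁, hx₂⟩ := (hrun _).1 hx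
    simpa [FreeGroup.mk_toWord] using h.mk_mem_closure hx₁ hx₂

end Intersection

theorem mainTheorem3 (n : ℕ) :
    ∃ f : AutData n × List (GWord n) × List (GWord n) →. List (GWord n),
      Partrec f ∧
      ∀ (G : Type*) [Group G] (γ : Fin n → G) (d : AutData n) (hs ks : List (GWord n)),
        IsAutomaticStructure γ d →
        IsQuasiConvex γ d.language (generatedBy γ hs : Set G) →
        IsQuasiConvex γ d.language (generatedBy γ ks : Set G) →
        ∃ out ∈ f (d, hs, ks),
          generatedBy γ out = generatedBy γ hs ⊓ generatedBy γ ks ∧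
          (Subgroup.closure {x : FreeGroup (Fin n) | ∃ w ∈ out, FreeGroup.mk w = x} :
              Set (FreeGroup (Fin n))) =
            (stallingsProduct γ d.language (generatedBy γ hs) (generatedBy γ ks)).loopSet
              (rightCoset (generatedBy γ hs) 1, rightCoset (generatedBy γ ks) 1) := by
  obtain ⟨f, hf, hspec⟩ := SemiDec.exists_partrec
    (p := fun (x : AutData n × List (GWord n) × List (GWord n)) out =>
      IntersectionCert x.1 x.2.1 x.2.2 out)
    (.intersectionCert (by fun_prop) (by fun_prop) (by fun_prop) (by fun_prop))
  refine ⟨f, hf, fun G _ γ d hs ks hd hH hK => ?_⟩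
  obtain ⟨Δ₁, h₁⟩ := exists_stallingsCert hd hH
  obtain ⟨Δ₂, h₂⟩ := exists_stallingsCert hd hK
  obtain ⟨τ, out, hτ⟩ := exists_spanningCert
    (fun _ _ _ hu hv => h₁.run_append_invRev hd hu hv)
    (fun _ _ _ hu hv => h₂.run_append_invRev hd hu hv)
  obtain ⟨out, hout, Δ₁, Δ₂, τ, h₁, h₂, hτ⟩ :=
    hspec (d, hs, ks) ⟨out, Δ₁, Δ₂, τ, h₁, h₂, hτ⟩
  have hloop := hτ.closure_eq_loopSet hd h₁ h₂
  exact ⟨out, hout, generatedBy_eq_inf hd.1 hloop, hloop⟩
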